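/- Let $G = \langle x, y, t \mid x^y = x^2,\ x^t = y\rangle$ be the Baumslag–Gersten group, where $a^b$ denotes $b^{-1}ab$. Then the outer automorphism group $\mathrm{Out}(G) = \mathrm{Aut}(G)/\mathrm{Inn}(G)$ is isomorphic to the additive group of dyadic rationals $\mathbb{Z}[1/2] = \langle \tfrac12, \tfrac14, \tfrac18, \dots\rangle$, the subgroup of $(\mathbb{Q}, +)$ generated by the numbers $2^{-n}$, $n \ge 1$. The group $\mathbb{Z}[1/2]$ is not finitely generated. -/

import Mathlib

/-- The conjugate `a ^ b = b⁻¹ a b`. -/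
def rightConj {Γ : Type*} [Group Γ] (a b : Γ) : Γ := b⁻¹ * a * b

/-- The three generators of the Baumslag–Gersten group. -/
inductive BGGen : Type
  | x
  | y
  | t

/-- The relators of `⟨x, y, t | x ^ y = x ^ 2, x ^ t = y⟩`, each relation `u = v` being
written as the relator `u * v⁻¹`. -/
def bgRelators : Set (FreeGroup BGGen) :=
  {rightConj (FreeGroup.of BGGen.x) (FreeGroup.of BGGen.y) * (FreeGroup.of BGGen.x ^ 2)⁻¹,
   rightConj (FreeGroup.of BGGen.x) (FreeGroup.of BGGen.t) * (FreeGroup.of BGGen.y)⁻¹}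

/-- The Baumslag–Gersten group `⟨x, y, t | x ^ y = x ^ 2, x ^ t = y⟩`. -/
abbrev BaumslagGersten : Type := PresentedGroup bgRelators

/-- The subgroup of inner automorphisms. -/
abbrev Inn (Γ : Type*) [Group Γ] : Subgroup (MulAut Γ) := (MulAut.conj : Γ →* MulAut Γ).range

/-- Inner automorphisms form a normal subgroup of the automorphism group. -/
instance Inn.normal (Γ : Type*) [Group Γ] : (Inn Γ).Normal where
  conj_mem := by
    rintro _ ⟨g, rfl⟩ φ
    refine ⟨φ g, ?_⟩
    ext z
    simp [MulAut.mul_apply]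

/-- The outer automorphism group `Aut(Γ) / Inn(Γ)`. -/
abbrev Out (Γ : Type*) [Group Γ] : Type _ := MulAut Γ ⧸ Inn Γ

/-- The additive group of dyadic rationals: the subgroup of `(ℚ, +)` generated by
`1/2, 1/4, 1/8, …`. -/
def dyadicRationals : AddSubgroup ℚ :=
  AddSubgroup.closure (Set.range fun n : ℕ => (1 : ℚ) / 2 ^ (n + 1))

/-!
# The outer automorphism group of the Baumslag–Gersten group

The Baumslag–Gersten group `G` is an HNN extension of `H = ⟨x, y⟩ ≅ BS(1, 2) ≅ ℤ[1/2] ⋊ ℤ` whose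
stable letter `t` conjugates `⟨x⟩` to `⟨y⟩`. The centralizer of `x` in `H` is the translation
subgroup `ℤ[1/2]`, so for each `n` in it there is a twist of `G` that fixes `x` and `y` and sends
`t` to `n * t`. The twists form a copy of `ℤ[1/2]` in `Aut G`, and the claim is that they represent
every outer automorphism exactly once.

Everything rests on the action of `G` on its Bass–Serre tree, which is handled through the distance
function `treeDist` on `G / H`. Britton's lemma, applied after mapping `G` to an HNN extension of a
group of affine maps of `ℚ`, gives `IsBassSerre`, from which the distance is shown to be a tree
metric (`treeDist_four_point`).

* *Injectivity* (`outerTwist_injective`). A twist equal to conjugation by `g` makes `g` centralize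
  `H`. As `H` is not contained in an edge stabilizer, which is cyclic, it fixes only one vertex
  (`mem_vertexGroup_of_conj_mem`); hence `g` lies in `H`, whose centre is trivial.
* *Surjectivity* (`outerTwist_surjective`). Let `ψ` be an automorphism and `a, b` the images of `x`
  and `y`. From `b⁻¹ a b = a²` the powers of `a` are exponentially distorted, so `a`, and its
  conjugate `b`, cannot act hyperbolically. A midpoint argument then gives a vertex fixed by both
  (`exists_common_fixed`), so `ψ` maps `H` into a conjugate of `H`, and the same for `ψ⁻¹` makes it
  onto. Automorphisms of `BS(1, 2)` act on `ℤ[1/2]` by units `± 2ʳ`, so that after an inner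
  automorphism `ψ` fixes `y` and sends `x` to `x` or `x⁻¹`. Now `t * (ψ t)⁻¹` conjugates `x` to
  `x` or `x⁻¹`; it lies in `H` by `mem_vertexGroup_of_conj_x`, hence is a translation and centralizes
  `x`. Thus `ψ` is a twist.
-/

/-! ### Lengths in a group acting on a tree -/

/-- The data, on the group side, of an action on a tree `T` whose vertices include the orbit
`Γ / H` and where `S` is the set of `s` such that `sH` is adjacent to the vertex `H`. A list
`s₁, …, sₙ` of elements of `S` describes the edge path `H, s₁H, s₁s₂H, …`, which backtracks exactly
when some `sᵢ * sᵢ₊₁` lies in `H`; the field `britton` says that a path of positive length without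
backtracking is not closed. -/
structure IsBassSerre {Γ : Type*} [Group Γ] (H : Subgroup Γ) (S : Set Γ) : Prop where
  mul_left : ∀ h ∈ H, ∀ s ∈ S, h * s ∈ S
  mul_right : ∀ h ∈ H, ∀ s ∈ S, s * h ∈ S
  inv : ∀ s ∈ S, s⁻¹ ∈ S
  generate : Subgroup.closure ((H : Set Γ) ∪ S) = ⊤
  britton : ∀ l : List Γ, l ≠ [] → (∀ s ∈ l, s ∈ S) → l.IsChain (fun a b => a * b ∉ H) →
    l.prod ∉ H

/-- A list of steps describing an edge path without backtracking. -/
def IsReducedPath {Γ : Type*} [Group Γ] (H : Subgroup Γ) (S : Set Γ) (l : List Γ) : Prop :=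
  (∀ s ∈ l, s ∈ S) ∧ l.IsChain (fun a b => a * b ∉ H)

namespace IsBassSerre

variable {Γ : Type*} [Group Γ] {H : Subgroup Γ} {S : Set Γ}

theorem prod_mem_iff (hT : IsBassSerre H S) {l : List Γ} (hl : IsReducedPath H S l) :
    l.prod ∈ H ↔ l = [] := by
  constructor
  · intro h
    by_contra hne
    exact hT.britton l hne hl.1 hl.2 h
  · rintro rfl
    simp [H.one_mem]

theorem exists_reduced_mul (hT : IsBassSerre H S) {h : Γ} (hh : h ∈ H) {l : List Γ}
    (hl : IsReducedPath H S l) :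
    ∃ l', IsReducedPath H S l' ∧ l'.length = l.length ∧ ∃ k ∈ H, h * l.prod = l'.prod * k := by
  cases l with
  | nil => exact ⟨[], hl, rfl, h, hh, by simp⟩
  | cons s l =>
    refine ⟨(h * s) :: l, ⟨?_, ?_⟩, rfl, 1, H.one_mem, by simp [mul_assoc]⟩
    · intro a ha
      rcases List.mem_cons.1 ha with rfl | ha
      · exact hT.mul_left h hh s (hl.1 s (by simp))
      · exact hl.1 a (by simp [ha])
    · have h2 := hl.2
      rw [List.isChain_cons] at h2 ⊢
      refine ⟨fun y hy hmem => h2.1 y hy ?_, h2.2⟩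
      rw [mul_assoc] at hmem
      exact (H.mul_mem_cancel_left hh).1 hmem

theorem tail_reduced {s : Γ} {l : List Γ} (hl : IsReducedPath H S (s :: l)) :
    IsReducedPath H S l :=
  ⟨fun a ha => hl.1 a (by simp [ha]), (List.isChain_cons.1 hl.2).2⟩

theorem reverse_append_reduced (hT : IsBassSerre H S) {s s' : Γ} {l l' : List Γ}
    (hl : IsReducedPath H S (s :: l)) (hl' : IsReducedPath H S (s' :: l'))
    (hs : s⁻¹ * s' ∉ H) :
    IsReducedPath H S (((s :: l).map (·⁻¹)).reverse ++ s' :: l') := by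
  constructor
  · intro a ha
    rcases List.mem_append.1 ha with ha | ha
    · rw [List.mem_reverse, List.mem_map] at ha
      obtain ⟨b, hb, rfl⟩ := ha
      exact hT.inv b (hl.1 b hb)
    · exact hl'.1 a ha
  · rw [List.isChain_append]
    refine ⟨?_, hl'.2, ?_⟩
    · rw [List.isChain_reverse, List.isChain_map]
      refine hl.2.imp fun a b hab hmem => hab ?_
      have := H.inv_mem hmem
      simpa using this
    · simpa using hs

theorem prod_inv_reverse (l : List Γ) : ((l.map (·⁻¹)).reverse).prod = l.prod⁻¹ := by
  rw [List.prod_inv_reverse]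

theorem length_eq (hT : IsBassSerre H S) {l l' : List Γ} (hl : IsReducedPath H S l)
    (hl' : IsReducedPath H S l') (h : l.prod⁻¹ * l'.prod ∈ H) : l.length = l'.length := by
  induction l generalizing l' with
  | nil =>
    rw [(hT.prod_mem_iff hl').1 (by simpa using h)]
  | cons s l ih =>
    cases l' with
    | nil =>
      have : (s :: l).prod ∈ H := by
        rw [← H.inv_mem_iff]
        simpa using h
      rw [(hT.prod_mem_iff hl).1 this]
    | cons s' l' =>
      by_cases hs : s⁻¹ * s' ∈ H
      · obtain ⟨l₂, hl₂, hlen, k, hk, hprod⟩ := hT.exists_reduced_mul hs (tail_reduced hl')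
        have := ih (tail_reduced hl) hl₂ (by
          have h2 : l.prod⁻¹ * l₂.prod * k ∈ H := by
            rw [mul_assoc, ← hprod]
            simpa [mul_assoc] using h
          exact (H.mul_mem_cancel_right hk).1 h2)
        simp [this, hlen]
      · have h1 := (hT.prod_mem_iff (hT.reverse_append_reduced hl hl' hs)).1 (by
          rw [List.prod_append, prod_inv_reverse]
          exact h)
        simp at h1

theorem exists_reduced (hT : IsBassSerre H S) (g : Γ) :
    ∃ l, IsReducedPath H S l ∧ l.prod⁻¹ * g ∈ H := by
  have key : ∀ a ∈ ((H : Set Γ) ∪ S), ∀ y : Γ, (∃ l, IsReducedPath H S l ∧ l.prod⁻¹ * y ∈ H) →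
      ∃ l, IsReducedPath H S l ∧ l.prod⁻¹ * (a * y) ∈ H := by
    rintro a (ha | ha) y ⟨l, hl, hy⟩
    · obtain ⟨l', hl', -, k, hk, hprod⟩ := hT.exists_reduced_mul ha hl
      refine ⟨l', hl', ?_⟩
      have : l'.prod⁻¹ * (a * y) = k * (l.prod⁻¹ * y) := by
        rw [eq_mul_inv_of_mul_eq hprod.symm]
        group
      rw [this]
      exact H.mul_mem hk hy
    · cases l with
      | nil =>
        refine ⟨[a], ⟨by simpa using ha, by simp⟩, ?_⟩
        simpa using hy
      | cons s l =>
        by_cases has : a * s ∈ H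
        · obtain ⟨l', hl', -, k, hk, hprod⟩ := hT.exists_reduced_mul has (tail_reduced hl)
          refine ⟨l', hl', ?_⟩
          have : l'.prod⁻¹ * (a * y) = k * ((s :: l).prod⁻¹ * y) := by
            rw [eq_mul_inv_of_mul_eq hprod.symm, List.prod_cons]
            group
          rw [this]
          exact H.mul_mem hk hy
        · refine ⟨a :: s :: l, ⟨?_, ?_⟩, ?_⟩
          · intro b hb
            rcases List.mem_cons.1 hb with rfl | hb
            · exact ha
            · exact hl.1 b hb
          · rw [List.isChain_cons_cons]
            exact ⟨has, hl.2⟩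
          · have : (a :: s :: l).prod⁻¹ * (a * y) = (s :: l).prod⁻¹ * y := by
              rw [List.prod_cons (a := a)]
              group
            rw [this]
            exact hy
  have hg : g ∈ Subgroup.closure ((H : Set Γ) ∪ S) := by
    rw [hT.generate]
    trivial
  induction hg using Subgroup.closure_induction_left with
  | one => exact ⟨[], ⟨by simp, by simp⟩, by simp [H.one_mem]⟩
  | mul_left a ha y _ ih => exact key a ha y ih
  | inv_mul_cancel a ha y _ ih =>
    refine key a⁻¹ ?_ y ih
    rcases ha with ha | ha
    · exact Or.inl (H.inv_mem ha)
    · exact Or.inr (hT.inv a ha)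

end IsBassSerre

open Classical in
/-- The distance, in the tree, between the vertices `H` and `gH`: the length of a path without
backtracking joining them (the value `0` is used if there is none). -/
noncomputable def treeLength {Γ : Type*} [Group Γ] (H : Subgroup Γ) (S : Set Γ) (g : Γ) : ℕ :=
  if h : ∃ l, IsReducedPath H S l ∧ l.prod⁻¹ * g ∈ H then h.choose.length else 0

namespace IsBassSerre

variable {Γ : Type*} [Group Γ] {H : Subgroup Γ} {S : Set Γ}

theorem treeLength_eq (hT : IsBassSerre H S) {l : List Γ} (hl : IsReducedPath H S l) {g : Γ}
    (h : l.prod⁻¹ * g ∈ H) : treeLength H S g = l.length := by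
  have hex : ∃ l, IsReducedPath H S l ∧ l.prod⁻¹ * g ∈ H := ⟨l, hl, h⟩
  rw [treeLength, dif_pos hex]
  refine hT.length_eq hex.choose_spec.1 hl ?_
  have := H.mul_mem hex.choose_spec.2 (H.inv_mem h)
  simpa [mul_assoc] using this

theorem treeLength_eq_zero_iff (hT : IsBassSerre H S) {g : Γ} :
    treeLength H S g = 0 ↔ g ∈ H := by
  obtain ⟨l, hl, hg⟩ := hT.exists_reduced g
  rw [hT.treeLength_eq hl hg, List.length_eq_zero_iff, ← hT.prod_mem_iff hl]
  constructor
  · intro h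
    simpa using H.mul_mem h hg
  · intro h
    have := H.mul_mem h (H.inv_mem hg)
    simpa [mul_assoc] using this

theorem treeLength_mul_right (hT : IsBassSerre H S) (g : Γ) {h : Γ} (hh : h ∈ H) :
    treeLength H S (g * h) = treeLength H S g := by
  obtain ⟨l, hl, hg⟩ := hT.exists_reduced g
  rw [hT.treeLength_eq hl hg, hT.treeLength_eq hl (g := g * h)]
  rw [← mul_assoc]
  exact H.mul_mem hg hh

theorem treeLength_mul_left (hT : IsBassSerre H S) {h : Γ} (hh : h ∈ H) (g : Γ) :
    treeLength H S (h * g) = treeLength H S g := by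
  obtain ⟨l, hl, hg⟩ := hT.exists_reduced g
  obtain ⟨l', hl', hlen, k, hk, hprod⟩ := hT.exists_reduced_mul hh hl
  rw [hT.treeLength_eq hl hg, ← hlen, hT.treeLength_eq hl']
  have : l'.prod⁻¹ * (h * g) = k * (l.prod⁻¹ * g) := by
    rw [eq_mul_inv_of_mul_eq hprod.symm]
    group
  rw [this]
  exact H.mul_mem hk hg

theorem exists_first_step (hT : IsBassSerre H S) {g : Γ} (hg : treeLength H S g ≠ 0) :
    ∃ s ∈ S, treeLength H S (s⁻¹ * g) + 1 = treeLength H S g := by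
  obtain ⟨l, hl, hlg⟩ := hT.exists_reduced g
  rw [hT.treeLength_eq hl hlg] at hg ⊢
  cases l with
  | nil => simp at hg
  | cons s l =>
    refine ⟨s, hl.1 s (by simp), ?_⟩
    rw [hT.treeLength_eq (tail_reduced hl) (g := s⁻¹ * g)]
    · simp
    · simpa [mul_assoc] using hlg

theorem exists_reduced_of_first_step (hT : IsBassSerre H S) {s g : Γ} (hs : s ∈ S)
    (h : treeLength H S (s⁻¹ * g) + 1 = treeLength H S g) :
    ∃ l, IsReducedPath H S (s :: l) ∧ (s :: l).prod⁻¹ * g ∈ H := by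
  obtain ⟨l, hl, hlg⟩ := hT.exists_reduced (s⁻¹ * g)
  have hmem : (s :: l).prod⁻¹ * g ∈ H := by simpa [mul_assoc] using hlg
  refine ⟨l, ⟨?_, ?_⟩, hmem⟩
  · intro a ha
    rcases List.mem_cons.1 ha with rfl | ha
    · exact hs
    · exact hl.1 a ha
  · rw [List.isChain_cons]
    refine ⟨?_, hl.2⟩
    intro b hb hsb
    cases l with
    | nil => simp at hb
    | cons c l =>
      obtain rfl : c = b := by simpa using hb
      obtain ⟨l', hl', hlen, k, hk, hprod⟩ := hT.exists_reduced_mul hsb (tail_reduced hl)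
      have h1 := hT.treeLength_eq hl hlg
      have h2 : treeLength H S g = l'.length := by
        refine hT.treeLength_eq hl' ?_
        have : l'.prod⁻¹ * g = k * ((s :: c :: l).prod⁻¹ * g) := by
          rw [eq_mul_inv_of_mul_eq hprod.symm, List.prod_cons, List.prod_cons]
          group
        rw [this]
        exact H.mul_mem hk hmem
      rw [List.length_cons] at h1
      omega

/-- Two geodesics issuing from `H` in different directions together form a geodesic. -/
theorem treeLength_inv_mul_of_diverge (hT : IsBassSerre H S) {s s' g g' : Γ} (hs : s ∈ S)
    (hs' : s' ∈ S) (h : treeLength H S (s⁻¹ * g) + 1 = treeLength H S g)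
    (h' : treeLength H S (s'⁻¹ * g') + 1 = treeLength H S g') (hne : s⁻¹ * s' ∉ H) :
    treeLength H S (g⁻¹ * g') = treeLength H S g + treeLength H S g' := by
  obtain ⟨l, hl, hlg⟩ := hT.exists_reduced_of_first_step hs h
  obtain ⟨l', hl', hlg'⟩ := hT.exists_reduced_of_first_step hs' h'
  have hred := hT.reverse_append_reduced hl hl' hne
  rw [hT.treeLength_eq hl hlg, hT.treeLength_eq hl' hlg']
  have e : g⁻¹ * g' = ((s :: l).prod⁻¹ * g)⁻¹ *
      (((s :: l).prod⁻¹ * (s' :: l').prod) * ((s' :: l').prod⁻¹ * g')) := by group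
  rw [e, hT.treeLength_mul_left (H.inv_mem hlg), hT.treeLength_mul_right _ hlg',
    hT.treeLength_eq hred (by
      rw [List.prod_append, prod_inv_reverse, inv_mul_cancel]
      exact H.one_mem)]
  simp only [List.length_append, List.length_reverse, List.length_map, List.length_cons]

theorem treeLength_of_mem (hT : IsBassSerre H S) {s : Γ} (hs : s ∈ S) :
    treeLength H S s = 1 := by
  rw [hT.treeLength_eq (l := [s]) ⟨by simpa using hs, by simp⟩ (by simp [H.one_mem])]
  rfl

theorem treeLength_step (hT : IsBassSerre H S) {s : Γ} (hs : s ∈ S) (g : Γ) :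
    treeLength H S (s⁻¹ * g) + 1 = treeLength H S g ∨
      treeLength H S (s⁻¹ * g) = treeLength H S g + 1 := by
  by_cases h0 : treeLength H S g = 0
  · right
    rw [hT.treeLength_mul_right _ (hT.treeLength_eq_zero_iff.1 h0), h0,
      hT.treeLength_of_mem (hT.inv s hs)]
  · obtain ⟨s', hs', h'⟩ := hT.exists_first_step h0
    by_cases hss : s⁻¹ * s' ∈ H
    · left
      have : s⁻¹ * g = (s⁻¹ * s') * (s'⁻¹ * g) := by group
      rw [this, hT.treeLength_mul_left hss, h']
    · right
      rw [hT.treeLength_inv_mul_of_diverge hs hs' (by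
        rw [inv_mul_cancel, hT.treeLength_eq_zero_iff.2 H.one_mem, hT.treeLength_of_mem hs])
        h' hss, hT.treeLength_of_mem hs, add_comm]

theorem treeLength_inv (hT : IsBassSerre H S) (g : Γ) :
    treeLength H S g⁻¹ = treeLength H S g := by
  obtain ⟨l, hl, hlg⟩ := hT.exists_reduced g
  have hred : IsReducedPath H S (l.map (·⁻¹)).reverse := by
    constructor
    · intro a ha
      rw [List.mem_reverse, List.mem_map] at ha
      obtain ⟨b, hb, rfl⟩ := ha
      exact hT.inv b (hl.1 b hb)
    · rw [List.isChain_reverse, List.isChain_map]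
      refine hl.2.imp fun a b hab hmem => hab ?_
      simpa using H.inv_mem hmem
  have e : g⁻¹ = (l.prod⁻¹ * g)⁻¹ * l.prod⁻¹ := by group
  rw [e, hT.treeLength_mul_left (H.inv_mem hlg), hT.treeLength_eq hl hlg,
    hT.treeLength_eq hred (by rw [prod_inv_reverse, inv_mul_cancel]; exact H.one_mem)]
  simp

/-- The triangle inequality and the bipartiteness of the tree. -/
theorem treeLength_mul (hT : IsBassSerre H S) (g g' : Γ) :
    treeLength H S (g * g') ≤ treeLength H S g + treeLength H S g' ∧
      Even (treeLength H S (g * g') + treeLength H S g + treeLength H S g') := by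
  induction hn : treeLength H S g generalizing g with
  | zero =>
    rw [hT.treeLength_mul_left (hT.treeLength_eq_zero_iff.1 hn)]
    simp
  | succ n ih =>
    obtain ⟨s, hs, hsg⟩ := hT.exists_first_step (g := g) (by omega)
    obtain ⟨h1, h2⟩ := ih (s⁻¹ * g) (by omega)
    have h3 := hT.treeLength_step hs (g * g')
    rw [← mul_assoc] at h3
    rw [Nat.even_iff] at h2 ⊢
    omega

end IsBassSerre

/-! ### Tree geometry and elliptic elements -/

/-- The distance, in the tree, between the vertices `uH` and `vH`. -/
noncomputable def treeDist {Γ : Type*} [Group Γ] (H : Subgroup Γ) (S : Set Γ) (u v : Γ) : ℕ :=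
  treeLength H S (u⁻¹ * v)

namespace IsBassSerre

variable {Γ : Type*} [Group Γ] {H : Subgroup Γ} {S : Set Γ}

theorem treeDist_mul_left (g u v : Γ) : treeDist H S (g * u) (g * v) = treeDist H S u v := by
  simp [treeDist, mul_assoc]

theorem treeDist_eq_zero_iff (hT : IsBassSerre H S) {u v : Γ} :
    treeDist H S u v = 0 ↔ u⁻¹ * v ∈ H :=
  hT.treeLength_eq_zero_iff

theorem treeDist_self (hT : IsBassSerre H S) (u : Γ) : treeDist H S u u = 0 := by
  rw [hT.treeDist_eq_zero_iff, inv_mul_cancel]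
  exact H.one_mem

theorem treeDist_comm (hT : IsBassSerre H S) (u v : Γ) : treeDist H S u v = treeDist H S v u := by
  rw [treeDist, treeDist, ← hT.treeLength_inv]
  simp

theorem treeDist_triangle (hT : IsBassSerre H S) (u v w : Γ) :
    treeDist H S u w ≤ treeDist H S u v + treeDist H S v w := by
  have := (hT.treeLength_mul (u⁻¹ * v) (v⁻¹ * w)).1
  simpa [treeDist, mul_assoc] using this

/-- The four-point condition: the tree is `0`-hyperbolic. -/
theorem treeDist_four_point (hT : IsBassSerre H S) (a b c d : Γ) :
    treeDist H S a b + treeDist H S c d ≤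
      max (treeDist H S a c + treeDist H S b d) (treeDist H S a d + treeDist H S b c) := by
  induction hn : treeDist H S a b generalizing a with
  | zero =>
    have h1 := hT.treeDist_triangle b a d
    have h2 := hT.treeDist_triangle c a d
    have h3 := hT.treeDist_triangle a b d
    have := hT.treeDist_comm a b
    have := hT.treeDist_comm a c
    omega
  | succ n ih =>
    have hcd := hT.treeDist_triangle c a d
    have eab := hT.treeDist_comm a b
    have eac := hT.treeDist_comm a c
    have ebc := hT.treeDist_comm b c
    by_cases hc0 : treeDist H S a c = 0
    · have := hT.treeDist_triangle b c a
      omega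
    by_cases hd0 : treeDist H S a d = 0
    · have := hT.treeDist_triangle b d a
      have := hT.treeDist_comm a d
      have := hT.treeDist_comm b d
      omega
    obtain ⟨p, hp, hpb⟩ := hT.exists_first_step (g := a⁻¹ * b) (by
      change treeDist H S a b ≠ 0
      omega)
    obtain ⟨q, hq, hqc⟩ := hT.exists_first_step hc0
    obtain ⟨r, hr, hrd⟩ := hT.exists_first_step hd0
    have diverge : ∀ {s s' z z' : Γ}, s ∈ S → s' ∈ S →
        treeLength H S (s⁻¹ * (a⁻¹ * z)) + 1 = treeLength H S (a⁻¹ * z) →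
        treeLength H S (s'⁻¹ * (a⁻¹ * z')) + 1 = treeLength H S (a⁻¹ * z') → s⁻¹ * s' ∉ H →
        treeDist H S z z' = treeDist H S a z + treeDist H S a z' := by
      intro s s' z z' hs hs' h h' hne
      have := hT.treeLength_inv_mul_of_diverge hs hs' h h' hne
      simpa [treeDist, mul_assoc] using this
    by_cases hpq : p⁻¹ * q ∈ H
    · by_cases hpr : p⁻¹ * r ∈ H
      · -- All three geodesics from `a` begin with the same edge, so `a` moves along it.
        have move : ∀ z : Γ, treeDist H S (a * p) z = treeLength H S (p⁻¹ * (a⁻¹ * z)) := by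
          intro z
          simp [treeDist, mul_assoc]
        have same : ∀ {s z : Γ}, p⁻¹ * s ∈ H →
            treeLength H S (p⁻¹ * (a⁻¹ * z)) = treeLength H S (s⁻¹ * (a⁻¹ * z)) := by
          intro s z hps
          rw [← hT.treeLength_mul_left hps (s⁻¹ * (a⁻¹ * z))]
          congr 1
          group
        have mb := move b
        have mc := (move c).trans (same hpq)
        have md := (move d).trans (same hpr)
        have hab : treeDist H S a b = treeLength H S (a⁻¹ * b) := rfl
        have hac : treeDist H S a c = treeLength H S (a⁻¹ * c) := rfl
        have had : treeDist H S a d = treeLength H S (a⁻¹ * d) := rfl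
        have := ih (a * p) (by omega)
        omega
      · have := diverge hp hr hpb hrd hpr
        omega
    · have := diverge hp hq hpb hqc hpq
      omega

/-- Geodesics exist: there is a vertex at each intermediate distance. -/
theorem exists_treeDist_eq (hT : IsBassSerre H S) (u v : Γ) {n : ℕ} (hn : n ≤ treeDist H S u v) :
    ∃ p, treeDist H S u p = n ∧ treeDist H S p v + n = treeDist H S u v := by
  induction n with
  | zero => exact ⟨u, hT.treeDist_self u, rfl⟩
  | succ n ih =>
    obtain ⟨p, hp, hpv⟩ := ih (by omega)
    obtain ⟨s, hs, hsv⟩ := hT.exists_first_step (g := p⁻¹ * v) (by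
      change treeDist H S p v ≠ 0
      omega)
    have h1 : treeDist H S (p * s) v + 1 = treeDist H S p v := by
      simpa [treeDist, mul_assoc] using hsv
    have h2 : treeDist H S p (p * s) = 1 := by
      simpa [treeDist] using hT.treeLength_of_mem hs
    have h3 := hT.treeDist_triangle u p (p * s)
    have h4 := hT.treeDist_triangle u (p * s) v
    exact ⟨p * s, by omega, by omega⟩

/-- An element fixing `uH` and `vH` fixes every vertex `pH` of the geodesic between them. -/
theorem fixes_of_between (hT : IsBassSerre H S) {g u v p : Γ}
    (hp : treeDist H S u p + treeDist H S p v = treeDist H S u v)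
    (hu : treeDist H S u (g * u) = 0) (hv : treeDist H S v (g * v) = 0) :
    treeDist H S p (g * p) = 0 := by
  have h1 := hT.treeDist_four_point p (g * p) u v
  have h2 := hT.treeDist_triangle (g * p) (g * v) v
  have h3 := hT.treeDist_triangle (g * p) (g * u) u
  rw [treeDist_mul_left] at h2 h3
  have := hT.treeDist_comm p u
  have := hT.treeDist_comm v (g * v)
  have := hT.treeDist_comm u (g * u)
  omega

/-- A hyperbolic element has linearly growing displacement: if `g` moves some vertex `v` less
than `g ^ 2` does, then the distance from `v` to `g ^ n v` is at least `n - 1`. -/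
theorem le_treeDist_pow (hT : IsBassSerre H S) {g v : Γ}
    (h : treeDist H S v (g * v) < treeDist H S v (g ^ 2 * v)) (n : ℕ) :
    n ≤ treeDist H S v (g ^ n * v) + 1 := by
  have key : ∀ n, treeDist H S v (g * v) < treeDist H S v (g ^ (n + 2) * v) ∧
      treeDist H S v (g ^ (n + 1) * v) + 1 ≤ treeDist H S v (g ^ (n + 2) * v) := by
    intro n
    induction n with
    | zero => simpa using h
    | succ n ih =>
      have h4 := hT.treeDist_four_point v (g ^ (n + 2) * v) (g * v) (g ^ (n + 3) * v)
      have e1 : treeDist H S (g * v) (g ^ (n + 3) * v) = treeDist H S v (g ^ (n + 2) * v) := by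
        rw [show g ^ (n + 3) = g * g ^ (n + 2) from pow_succ' _ _, mul_assoc, treeDist_mul_left]
      have e2 : treeDist H S (g ^ (n + 2) * v) (g ^ (n + 3) * v) = treeDist H S v (g * v) := by
        rw [show g ^ (n + 3) = g ^ (n + 2) * g from pow_succ _ _, mul_assoc, treeDist_mul_left]
      have e3 : treeDist H S (g ^ (n + 2) * v) (g * v) = treeDist H S v (g ^ (n + 1) * v) := by
        rw [show g ^ (n + 2) = g * g ^ (n + 1) from pow_succ' _ _, mul_assoc, treeDist_mul_left,
          hT.treeDist_comm]
      rw [show n + 1 + 2 = n + 3 from rfl, show n + 1 + 1 = n + 2 from rfl]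
      omega
  have : ∀ n, n ≤ treeDist H S v (g ^ (n + 1) * v) := by
    intro n
    induction n with
    | zero => simp
    | succ n ih =>
      have := (key n).2
      rw [show n + 1 + 1 = n + 2 from rfl]
      omega
  cases n with
  | zero => simp
  | succ n =>
    have := this n
    omega

/-- An element that displaces `v` by an even distance, and at least as far as its square does,
fixes the midpoint between `v` and its image. -/
theorem fixes_midpoint (hT : IsBassSerre H S) {g v p : Γ} {n : ℕ}
    (h : treeDist H S v (g ^ 2 * v) ≤ treeDist H S v (g * v))
    (hn : treeDist H S v (g * v) = 2 * n) (hp : treeDist H S v p = n)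
    (hp' : treeDist H S p (g * v) = n) : treeDist H S p (g * p) = 0 := by
  have e1 : treeDist H S (g * v) (g * p) = n := by rw [treeDist_mul_left, hp]
  have e2 : treeDist H S (g * p) (g ^ 2 * v) = n := by
    rw [pow_two, mul_assoc, treeDist_mul_left, hp']
  have e3 : treeDist H S (g * v) (g ^ 2 * v) = 2 * n := by
    rw [pow_two, mul_assoc, treeDist_mul_left, hn]
  have h1 := hT.treeDist_four_point (g * p) v (g * v) (g ^ 2 * v)
  have h2 := hT.treeDist_four_point p (g * p) v (g * v)
  have := hT.treeDist_comm (g * v) (g * p)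
  have := hT.treeDist_comm p v
  omega

theorem treeLength_conj_pow_le (hT : IsBassSerre H S) (a b : Γ) (n : ℕ) :
    treeLength H S (b⁻¹ ^ n * a * b ^ n) ≤ treeLength H S a + 2 * n * treeLength H S b := by
  induction n with
  | zero => simp
  | succ n ih =>
    have e : b⁻¹ ^ (n + 1) * a * b ^ (n + 1) = b⁻¹ * (b⁻¹ ^ n * a * b ^ n) * b := by
      rw [pow_succ', pow_succ]
      group
    have h1 := (hT.treeLength_mul (b⁻¹ * (b⁻¹ ^ n * a * b ^ n)) b).1
    have h2 := (hT.treeLength_mul b⁻¹ (b⁻¹ ^ n * a * b ^ n)).1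
    rw [hT.treeLength_inv] at h2
    rw [e]
    have e2 : 2 * (n + 1) * treeLength H S b
        = 2 * n * treeLength H S b + 2 * treeLength H S b := by ring
    omega

/-- An element conjugate to one whose powers are exponentially distorted is not hyperbolic. -/
theorem treeDist_sq_le_of_distorted (hT : IsBassSerre H S) {a b c : Γ}
    (hab : b⁻¹ * a * b = a ^ 2) (v : Γ) :
    treeDist H S v ((c⁻¹ * a * c) ^ 2 * v) ≤ treeDist H S v ((c⁻¹ * a * c) * v) := by
  by_contra! hlt
  have hpow : ∀ n : ℕ, b⁻¹ ^ n * a * b ^ n = a ^ 2 ^ n := by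
    intro n
    induction n with
    | zero => simp
    | succ n ih =>
      have e : b⁻¹ ^ (n + 1) * a * b ^ (n + 1) = b⁻¹ * (b⁻¹ ^ n * a * b ^ n) * b := by
        rw [pow_succ', pow_succ]
        group
      have hc : b⁻¹ * a ^ 2 ^ n * b = (b⁻¹ * a * b) ^ 2 ^ n := by
        have := conj_pow (i := 2 ^ n) (a := b⁻¹) (b := a)
        rw [inv_inv] at this
        exact this.symm
      rw [e, ih, hc, hab, ← pow_mul, pow_succ']
  obtain ⟨K, hK⟩ : ∃ K, ∀ n : ℕ, 2 ^ n ≤ K + 2 * n * treeLength H S b := by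
    refine ⟨1 + 2 * treeLength H S (c * v) + treeLength H S a, fun n => ?_⟩
    have h1 := hT.le_treeDist_pow hlt (2 ^ n)
    have e : treeDist H S v ((c⁻¹ * a * c) ^ 2 ^ n * v)
        = treeLength H S ((c * v)⁻¹ * (a ^ 2 ^ n) * (c * v)) := by
      have := conj_pow (i := 2 ^ n) (a := c⁻¹) (b := a)
      rw [inv_inv] at this
      rw [this, treeDist]
      congr 1
      group
    rw [e, ← hpow] at h1
    have h2 := (hT.treeLength_mul ((c * v)⁻¹ * (b⁻¹ ^ n * a * b ^ n)) (c * v)).1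
    have h3 := (hT.treeLength_mul (c * v)⁻¹ (b⁻¹ ^ n * a * b ^ n)).1
    rw [hT.treeLength_inv] at h3
    have h4 := hT.treeLength_conj_pow_le a b n
    omega
  -- `2 ^ (2 * m)` outgrows every linear function of `m`
  have hsq : ∀ m : ℕ, (m + 1) * (m + 1) ≤ 2 ^ (2 * m) := by
    intro m
    have : m + 1 ≤ 2 ^ m := Nat.lt_two_pow_self
    rw [two_mul, pow_add]
    exact Nat.mul_le_mul this this
  have h1 := hK (2 * (K + 4 * treeLength H S b))
  have h2 := hsq (K + 4 * treeLength H S b)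
  nlinarith [h1, h2]

/-- If `b⁻¹ a b = a²` and `b` is conjugate to `a`, then `a` and `b` fix a common vertex. -/
theorem exists_common_fixed (hT : IsBassSerre H S) {a b c : Γ}
    (hab : b⁻¹ * a * b = a ^ 2) (hc : c⁻¹ * a * c = b) :
    ∃ v : Γ, v⁻¹ * a * v ∈ H ∧ v⁻¹ * b * v ∈ H := by
  -- Lengths modulo `2` define a homomorphism, which kills `a = [a, b]` and its conjugate `b`.
  have even_mul : ∀ g g' : Γ, (treeLength H S (g * g') + treeLength H S g +
      treeLength H S g') % 2 = 0 := fun g g' => Nat.even_iff.1 (hT.treeLength_mul g g').2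
  have hab' : a * b = b * a * a := by
    rw [pow_two] at hab
    rw [mul_assoc b a a, ← hab]
    group
  have even_a : treeLength H S a % 2 = 0 := by
    have h1 := even_mul a b
    have h2 := even_mul (b * a) a
    have h3 := even_mul b a
    rw [hab'] at h1
    omega
  have even_conj : ∀ g d : Γ, treeLength H S g % 2 = 0 →
      treeLength H S (d⁻¹ * g * d) % 2 = 0 := by
    intro g d hg
    have h1 := even_mul (d⁻¹ * g) d
    have h2 := even_mul d⁻¹ g
    have h3 := hT.treeLength_inv d
    omega
  have even_b : treeLength H S b % 2 = 0 := by
    rw [← hc]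
    exact even_conj a c even_a
  have exists_mid : ∀ g v : Γ, treeLength H S g % 2 = 0 →
      treeDist H S v (g ^ 2 * v) ≤ treeDist H S v (g * v) →
      ∃ p, treeDist H S p (g * p) = 0 ∧
        treeDist H S v p + treeDist H S p (g * v) = treeDist H S v (g * v) := by
    intro g v hg h
    have hev := even_conj g v hg
    rw [mul_assoc] at hev
    have hev' : treeDist H S v (g * v) = 2 * (treeDist H S v (g * v) / 2) := by
      change treeLength H S (v⁻¹ * (g * v)) = 2 * (treeLength H S (v⁻¹ * (g * v)) / 2)
      omega
    obtain ⟨p, hp, hp'⟩ := hT.exists_treeDist_eq v (g * v)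
      (n := treeDist H S v (g * v) / 2) (by omega)
    exact ⟨p, hT.fixes_midpoint h hev' hp (by omega), by omega⟩
  have ha := hT.treeDist_sq_le_of_distorted hab (c := 1)
  simp only [inv_one, one_mul, mul_one] at ha
  have hb := hT.treeDist_sq_le_of_distorted hab (c := c)
  rw [hc] at hb
  obtain ⟨q, hq, -⟩ := exists_mid a 1 even_a (ha 1)
  -- `a²` fixes `q` and `b⁻¹ q`, hence the midpoint `r` of `b⁻¹ q` and `q`, which `b` fixes too.
  obtain ⟨r, hr, hr'⟩ := exists_mid b (b⁻¹ * q) even_b (hb _)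
  rw [mul_inv_cancel_left] at hr'
  have hq2 : treeDist H S q (a ^ 2 * q) = 0 := by
    have := hT.treeDist_triangle q (a * q) (a ^ 2 * q)
    rw [pow_two, mul_assoc, treeDist_mul_left, ← mul_assoc, ← pow_two] at this
    omega
  have hbq2 : treeDist H S (b⁻¹ * q) (a ^ 2 * (b⁻¹ * q)) = 0 := by
    have : a ^ 2 * (b⁻¹ * q) = b⁻¹ * (a * q) := by
      rw [← hab]
      group
    rw [this, treeDist_mul_left, hq]
  have hr2 := hT.fixes_of_between hr' hbq2 hq2
  rw [hT.treeDist_eq_zero_iff] at hr hr2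
  refine ⟨r, ?_, by simpa [mul_assoc] using hr⟩
  have e : r⁻¹ * a * r = (r⁻¹ * (b * r)) * (r⁻¹ * (a ^ 2 * r)) * (r⁻¹ * (b * r))⁻¹ := by
    rw [← hab]
    group
  rw [e]
  exact H.mul_mem (H.mul_mem hr hr2) (H.inv_mem hr)

end IsBassSerre

/-! ### The dyadic affine group -/

/-- The group of affine maps `q ↦ 2⁻ⁿ q + b` of the rational line. -/
@[ext]
structure BinaryAffine : Type where
  /-- The map scales by `2⁻ⁿ`. -/
  n : ℤ
  /-- The image of `0`. -/
  b : ℚ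

namespace BinaryAffine

instance : Mul BinaryAffine := ⟨fun p q => ⟨p.n + q.n, p.b + 2 ^ (-p.n) * q.b⟩⟩
instance : One BinaryAffine := ⟨⟨0, 0⟩⟩
instance : Inv BinaryAffine := ⟨fun p => ⟨-p.n, -(2 ^ p.n * p.b)⟩⟩

@[simp] theorem mul_n (p q : BinaryAffine) : (p * q).n = p.n + q.n := rfl
@[simp] theorem mul_b (p q : BinaryAffine) : (p * q).b = p.b + 2 ^ (-p.n) * q.b := rfl
@[simp] theorem one_n : (1 : BinaryAffine).n = 0 := rfl
@[simp] theorem one_b : (1 : BinaryAffine).b = 0 := rfl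
@[simp] theorem inv_n (p : BinaryAffine) : p⁻¹.n = -p.n := rfl
@[simp] theorem inv_b (p : BinaryAffine) : p⁻¹.b = -(2 ^ p.n * p.b) := rfl

instance : Group BinaryAffine :=
  Group.ofLeftAxioms
    (by
      intro p q r
      ext
      · simp [add_assoc]
      · simp only [mul_b, mul_n, neg_add, zpow_add₀ (two_ne_zero' ℚ)]
        ring)
    (by intro p; ext <;> simp)
    (by intro p; ext <;> simp)

theorem pow_n (p : BinaryAffine) (i : ℕ) : (p ^ i).n = i * p.n := by
  induction i with
  | zero => simp
  | succ i ih =>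
    rw [pow_succ, mul_n, ih]
    push_cast
    ring

/-- The translation `q ↦ q + b`. -/
def translation (b : ℚ) : BinaryAffine := ⟨0, b⟩

/-- The scaling `q ↦ 2⁻ⁿ q`. -/
def scaling (n : ℤ) : BinaryAffine := ⟨n, 0⟩

@[simp] theorem translation_n (b : ℚ) : (translation b).n = 0 := rfl
@[simp] theorem translation_b (b : ℚ) : (translation b).b = b := rfl
@[simp] theorem scaling_n (n : ℤ) : (scaling n).n = n := rfl
@[simp] theorem scaling_b (n : ℤ) : (scaling n).b = 0 := rfl

theorem translation_add (b c : ℚ) : translation (b + c) = translation b * translation c := by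
  ext <;> simp

theorem scaling_add (n m : ℤ) : scaling (n + m) = scaling n * scaling m := by
  ext <;> simp

/-- The subgroup `ℤ` of translations, as a homomorphism. -/
def translationHom : Multiplicative ℤ →* BinaryAffine where
  toFun k := translation (k.toAdd : ℤ)
  map_one' := by ext <;> simp
  map_mul' k l := by simp [translation_add]

/-- The subgroup of scalings, as a homomorphism. -/
def scalingHom : Multiplicative ℤ →* BinaryAffine where
  toFun k := scaling k.toAdd
  map_one' := by ext <;> simp
  map_mul' k l := by simp [scaling_add]

theorem translationHom_injective : Function.Injective translationHom := by
  intro k l h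
  have := congrArg BinaryAffine.b h
  simpa [translationHom] using this

theorem scalingHom_injective : Function.Injective scalingHom := by
  intro k l h
  have := congrArg BinaryAffine.n h
  simpa [scalingHom] using this

theorem translation_zpow (c : ℚ) (k : ℤ) : translation c ^ k = translation (k * c) := by
  let f : Multiplicative ℚ →* BinaryAffine :=
    { toFun := fun q => translation q.toAdd
      map_one' := by ext <;> simp
      map_mul' := fun k l => by simp [translation_add] }
  have h := map_zpow f (Multiplicative.ofAdd c) k
  rw [← ofAdd_zsmul] at h
  simpa [f] using h.symm

theorem translation_one_zpow (k : ℤ) : translation 1 ^ k = translation k := by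
  rw [translation_zpow, mul_one]

theorem scaling_one_zpow (k : ℤ) : scaling 1 ^ k = scaling k := by
  have h := map_zpow scalingHom (Multiplicative.ofAdd (1 : ℤ)) k
  rw [← ofAdd_zsmul] at h
  simpa [scalingHom] using h.symm

/-- The isomorphism from the scalings to the integral translations matching the generators. -/
noncomputable def scalingEquivTranslation :
    scalingHom.range ≃* translationHom.range :=
  (MonoidHom.ofInjective scalingHom_injective).symm.trans
    (MonoidHom.ofInjective translationHom_injective)

theorem scalingEquivTranslation_apply (k : Multiplicative ℤ) :
    (scalingEquivTranslation ⟨scalingHom k, k, rfl⟩ : BinaryAffine) = translationHom k := by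
  have : (⟨scalingHom k, k, rfl⟩ : scalingHom.range)
      = MonoidHom.ofInjective scalingHom_injective k := rfl
  rw [this, scalingEquivTranslation, MulEquiv.trans_apply, MulEquiv.symm_apply_apply,
    MonoidHom.ofInjective_apply]

end BinaryAffine

/-! ### The vertex group -/

namespace BaumslagGersten

open BinaryAffine

/-- The generator `x`. -/
def x : BaumslagGersten := PresentedGroup.of BGGen.x

/-- The generator `y`. -/
def y : BaumslagGersten := PresentedGroup.of BGGen.y

/-- The generator `t`, the stable letter. -/
def t : BaumslagGersten := PresentedGroup.of BGGen.t

theorem y_inv_mul_x_mul_y : y⁻¹ * x * y = x ^ 2 := by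
  have : PresentedGroup.mk bgRelators (rightConj (FreeGroup.of BGGen.x) (FreeGroup.of BGGen.y) *
      (FreeGroup.of BGGen.x ^ 2)⁻¹) = 1 :=
    PresentedGroup.one_of_mem (by simp [bgRelators])
  rw [map_mul, map_inv, mul_inv_eq_one] at this
  simpa [rightConj, x, y, t, PresentedGroup.of] using this

theorem t_inv_mul_x_mul_t : t⁻¹ * x * t = y := by
  have : PresentedGroup.mk bgRelators (rightConj (FreeGroup.of BGGen.x) (FreeGroup.of BGGen.t) *
      (FreeGroup.of BGGen.y)⁻¹) = 1 :=
    PresentedGroup.one_of_mem (by simp [bgRelators])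
  rw [map_mul, map_inv, mul_inv_eq_one] at this
  simpa [rightConj, x, y, t, PresentedGroup.of] using this

theorem relators_eq_one {Γ : Type*} [Group Γ] (f : BGGen → Γ)
    (h₁ : (f .y)⁻¹ * f .x * f .y = f .x ^ 2) (h₂ : (f .t)⁻¹ * f .x * f .t = f .y) :
    ∀ r ∈ bgRelators, FreeGroup.lift f r = 1 := by
  rintro r (rfl | rfl)
  · simp [rightConj, h₁]
  · simp [rightConj, h₂]

theorem hom_ext {Γ : Type*} [Group Γ] {f g : BaumslagGersten →* Γ} (hx : f x = g x)
    (hy : f y = g y) (ht : f t = g t) : f = g := by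
  apply PresentedGroup.ext
  rintro (_ | _ | _)
  · exact hx
  · exact hy
  · exact ht

theorem closure_eq_top : Subgroup.closure {x, y, t} = (⊤ : Subgroup BaumslagGersten) := by
  rw [eq_top_iff, ← PresentedGroup.closure_range_of, Subgroup.closure_le]
  rintro _ ⟨_ | _ | _, rfl⟩
  · exact Subgroup.subset_closure (by simp [x])
  · exact Subgroup.subset_closure (by simp [y])
  · exact Subgroup.subset_closure (by simp [t])

/-- The vertex group `⟨x, y⟩`, a copy of the Baumslag–Solitar group `BS(1, 2)`. -/
def vertexGroup : Subgroup BaumslagGersten := Subgroup.closure {x, y}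

theorem x_mem : x ∈ vertexGroup := Subgroup.subset_closure (by simp)
theorem y_mem : y ∈ vertexGroup := Subgroup.subset_closure (by simp)

/-- The HNN extension of the group of binary affine maps conjugating `q ↦ q / 2` to `q ↦ q + 1`.
Its base group is larger than `BS(1, 2)`, which does no harm as it only serves to detect reduced
words of the Baumslag–Gersten group. -/
abbrev AffineHNN : Type :=
  HNNExtension BinaryAffine scalingHom.range translationHom.range scalingEquivTranslation

theorem t_mul_scaling_mul_t_inv (k : ℤ) :
    (HNNExtension.t * HNNExtension.of (scaling k) * HNNExtension.t⁻¹ : AffineHNN)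
      = HNNExtension.of (translation k) := by
  have := HNNExtension.equiv_eq_conj (φ := scalingEquivTranslation)
    ⟨scalingHom (Multiplicative.ofAdd k), Multiplicative.ofAdd k, rfl⟩
  rw [scalingEquivTranslation_apply] at this
  exact this.symm

/-- The homomorphism to the affine HNN extension with `x ↦ (q ↦ q + 1)`, `y ↦ (q ↦ q / 2)`. -/
noncomputable def toAffineHNN : BaumslagGersten →* AffineHNN :=
  PresentedGroup.toGroup (f := fun g => match g with
    | .x => HNNExtension.of (translation 1)
    | .y => HNNExtension.of (scaling 1)
    | .t => HNNExtension.t) <| by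
  apply relators_eq_one
  · dsimp only
    rw [← map_inv, ← map_mul, ← map_mul, ← map_pow]
    congr 1
    ext <;> simp [pow_two]
    norm_num
  · dsimp only
    have := t_mul_scaling_mul_t_inv 1
    rw [Int.cast_one] at this
    rw [← this]
    group

@[simp] theorem toAffineHNN_x : toAffineHNN x = HNNExtension.of (translation 1) :=
  PresentedGroup.toGroup.of _
@[simp] theorem toAffineHNN_y : toAffineHNN y = HNNExtension.of (scaling 1) :=
  PresentedGroup.toGroup.of _
@[simp] theorem toAffineHNN_t : toAffineHNN t = HNNExtension.t :=
  PresentedGroup.toGroup.of _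

theorem exists_affine {h : BaumslagGersten} (hh : h ∈ vertexGroup) :
    ∃ p, HNNExtension.of p = toAffineHNN h := by
  have : vertexGroup ≤ (HNNExtension.of : BinaryAffine →* AffineHNN).range.comap toAffineHNN := by
    rw [vertexGroup, Subgroup.closure_le]
    rintro _ (rfl | rfl)
    · exact ⟨_, toAffineHNN_x.symm⟩
    · exact ⟨_, toAffineHNN_y.symm⟩
  exact this hh

/-- The representation of the vertex group by affine maps, `x ↦ (q ↦ q + 1)` and
`y ↦ (q ↦ q / 2)`. -/
noncomputable def affine : vertexGroup →* BinaryAffine where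
  toFun h := (exists_affine h.2).choose
  map_one' := HNNExtension.of_injective scalingEquivTranslation <| by
    rw [(exists_affine (1 : vertexGroup).2).choose_spec]
    simp
  map_mul' g h := HNNExtension.of_injective scalingEquivTranslation <| by
    rw [(exists_affine (g * h).2).choose_spec, map_mul, (exists_affine g.2).choose_spec,
      (exists_affine h.2).choose_spec]
    simp

theorem of_affine (h : vertexGroup) :
    (HNNExtension.of (affine h) : AffineHNN) = toAffineHNN h :=
  (exists_affine h.2).choose_spec

@[simp] theorem affine_x : affine ⟨x, x_mem⟩ = translation 1 :=
  HNNExtension.of_injective scalingEquivTranslation (by rw [of_affine, toAffineHNN_x])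

@[simp] theorem affine_y : affine ⟨y, y_mem⟩ = scaling 1 :=
  HNNExtension.of_injective scalingEquivTranslation (by rw [of_affine, toAffineHNN_y])

/-- The normal form of the elements of a quotient of `BS(1, 2)`. -/
theorem exists_normalForm {Γ : Type*} [Group Γ] {X Y : Γ} (hXY : Y⁻¹ * X * Y = X ^ 2) {g : Γ}
    (hg : g ∈ Subgroup.closure {X, Y}) :
    ∃ (i j : ℕ) (a : ℤ), g = Y ^ i * X ^ a * Y⁻¹ ^ j := by
  have hconj : ∀ a : ℤ, Y⁻¹ * X ^ a = X ^ (2 * a) * Y⁻¹ := by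
    intro a
    rw [zpow_mul, zpow_ofNat, ← hXY]
    have := conj_zpow (i := a) (a := Y⁻¹) (b := X)
    rw [inv_inv] at this
    rw [this]
    group
  have hpow : ∀ (i : ℕ) (a : ℤ), ∃ b : ℤ, X ^ a * Y ^ i = Y ^ i * X ^ b := by
    intro i a
    induction i with
    | zero => exact ⟨a, by simp⟩
    | succ i ih =>
      obtain ⟨b, hb⟩ := ih
      refine ⟨2 * b, ?_⟩
      rw [pow_succ, ← mul_assoc, hb]
      have : X ^ b * Y = Y * X ^ (2 * b) := by
        have h := hconj b
        rw [inv_mul_eq_iff_eq_mul, ← mul_assoc, eq_mul_inv_iff_mul_eq] at h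
        exact h
      rw [mul_assoc, this, mul_assoc]
  have key_x : ∀ (e : ℤ) (z : Γ), (∃ (i j : ℕ) (a : ℤ), z = Y ^ i * X ^ a * Y⁻¹ ^ j) →
      ∃ (i j : ℕ) (a : ℤ), X ^ e * z = Y ^ i * X ^ a * Y⁻¹ ^ j := by
    rintro e z ⟨i, j, a, rfl⟩
    obtain ⟨b, hb⟩ := hpow i e
    refine ⟨i, j, b + a, ?_⟩
    rw [← mul_assoc, ← mul_assoc, hb, zpow_add, mul_assoc (Y ^ i)]
  induction hg using Subgroup.closure_induction_left with
  | one => exact ⟨0, 0, 0, by simp⟩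
  | mul_left s hs z _ ih =>
    rcases hs with rfl | rfl
    · simpa using key_x 1 z ih
    · obtain ⟨i, j, a, rfl⟩ := ih
      exact ⟨i + 1, j, a, by rw [pow_succ']; group⟩
  | inv_mul_cancel s hs z _ ih =>
    rcases hs with rfl | rfl
    · simpa using key_x (-1) z ih
    · obtain ⟨i, j, a, rfl⟩ := ih
      cases i with
      | zero =>
        refine ⟨0, j + 1, 2 * a, ?_⟩
        rw [pow_zero, one_mul, one_mul, ← mul_assoc, hconj, pow_succ', mul_assoc]
      | succ i =>
        refine ⟨i, j, a, ?_⟩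
        rw [pow_succ']
        group

theorem affine_injective : Function.Injective affine := by
  rw [injective_iff_map_eq_one]
  rintro ⟨h, hh⟩ h1
  obtain ⟨i, j, a, hija⟩ := exists_normalForm y_inv_mul_x_mul_y hh
  have e : (⟨h, hh⟩ : vertexGroup)
      = ⟨y, y_mem⟩ ^ i * ⟨x, x_mem⟩ ^ a * ⟨y, y_mem⟩⁻¹ ^ j := Subtype.ext (by simpa using hija)
  rw [e] at h1
  simp only [map_mul, map_pow, map_zpow, affine_x, affine_y, map_inv, inv_pow,
    translation_one_zpow] at h1
  rw [← zpow_natCast, ← zpow_natCast, scaling_one_zpow, scaling_one_zpow] at h1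
  have hn := congrArg BinaryAffine.n h1
  have hb := congrArg BinaryAffine.b h1
  simp at hn hb
  obtain rfl : i = j := by omega
  subst hb
  apply Subtype.ext
  change h = 1
  rw [hija]
  simp

theorem affine_zpow_x (k : ℤ) : affine (⟨x, x_mem⟩ ^ k) = translation k := by
  rw [map_zpow, affine_x, translation_one_zpow]

theorem affine_zpow_y (k : ℤ) : affine (⟨y, y_mem⟩ ^ k) = scaling k := by
  rw [map_zpow, affine_y, scaling_one_zpow]

theorem eq_zpow_x_of_affine {h : BaumslagGersten} (hh : h ∈ vertexGroup) {k : ℤ}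
    (e : affine ⟨h, hh⟩ = translation k) : h = x ^ k := by
  rw [← affine_zpow_x] at e
  simpa using congrArg Subtype.val (affine_injective e)

theorem eq_zpow_y_of_affine {h : BaumslagGersten} (hh : h ∈ vertexGroup) {k : ℤ}
    (e : affine ⟨h, hh⟩ = scaling k) : h = y ^ k := by
  rw [← affine_zpow_y] at e
  simpa using congrArg Subtype.val (affine_injective e)

theorem mem_dyadicRationals_iff {q : ℚ} :
    q ∈ dyadicRationals ↔ ∃ (a : ℤ) (n : ℕ), q = a / 2 ^ n := by
  constructor
  · intro h
    induction h using AddSubgroup.closure_induction with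
    | mem q hq =>
      obtain ⟨n, rfl⟩ := hq
      exact ⟨1, n + 1, by simp⟩
    | zero => exact ⟨0, 0, by simp⟩
    | add p q _ _ hp hq =>
      obtain ⟨a, n, rfl⟩ := hp
      obtain ⟨b, m, rfl⟩ := hq
      refine ⟨a * 2 ^ m + b * 2 ^ n, n + m, ?_⟩
      push_cast
      rw [pow_add]
      field_simp
    | neg p _ hp =>
      obtain ⟨a, n, rfl⟩ := hp
      exact ⟨-a, n, by push_cast; ring⟩
  · rintro ⟨a, n, rfl⟩
    have h1 : (1 : ℚ) / 2 ^ (n + 1) ∈ dyadicRationals := AddSubgroup.subset_closure ⟨n, rfl⟩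
    have h2 := dyadicRationals.zsmul_mem h1 (2 * a)
    convert h2 using 1
    rw [zsmul_eq_mul, pow_succ]
    push_cast
    field_simp

theorem two_zpow_mul_mem {q : ℚ} (hq : q ∈ dyadicRationals) (n : ℤ) :
    (2 : ℚ) ^ n * q ∈ dyadicRationals := by
  rw [mem_dyadicRationals_iff] at hq ⊢
  obtain ⟨a, m, rfl⟩ := hq
  obtain ⟨k, rfl | rfl⟩ := n.eq_nat_or_neg
  · exact ⟨2 ^ k * a, m, by push_cast; rw [zpow_natCast]; ring⟩
  · refine ⟨a, k + m, ?_⟩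
    rw [zpow_neg, zpow_natCast, pow_add]
    field_simp

theorem affine_b_mem (h : vertexGroup) : (affine h).b ∈ dyadicRationals := by
  obtain ⟨h, hh⟩ := h
  obtain ⟨i, j, a, hija⟩ := exists_normalForm y_inv_mul_x_mul_y hh
  have e : (⟨h, hh⟩ : vertexGroup)
      = ⟨y, y_mem⟩ ^ (i : ℤ) * ⟨x, x_mem⟩ ^ a * ⟨y, y_mem⟩ ^ (-j : ℤ) :=
    Subtype.ext (by simpa using hija)
  rw [e, map_mul, map_mul, affine_zpow_x, affine_zpow_y, affine_zpow_y]
  simp only [mul_b, scaling_b, translation_b, zero_add, scaling_n, mul_zero, add_zero]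
  exact two_zpow_mul_mem (mem_dyadicRationals_iff.2 ⟨a, 0, by simp⟩) _

theorem exists_affine_eq (n : ℤ) {b : ℚ} (hb : b ∈ dyadicRationals) :
    ∃ h : vertexGroup, affine h = ⟨n, b⟩ := by
  obtain ⟨a, m, rfl⟩ := mem_dyadicRationals_iff.1 hb
  refine ⟨⟨y, y_mem⟩ ^ (m : ℤ) * ⟨x, x_mem⟩ ^ a * ⟨y, y_mem⟩ ^ (n - m), ?_⟩
  rw [map_mul, map_mul, affine_zpow_x, affine_zpow_y, affine_zpow_y]
  ext
  · simp
  · simp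
    field_simp

end BaumslagGersten

/-! ### The Bass–Serre tree of the Baumslag–Gersten group -/

namespace BaumslagGersten

open BinaryAffine HNNExtension

/-- The double cosets of `t` and `t⁻¹`, which carry the base vertex of the Bass–Serre tree to its
neighbours. -/
def steps : Set BaumslagGersten :=
  {s | ∃ h ∈ vertexGroup, ∃ u : ℤˣ, ∃ k ∈ vertexGroup, s = h * t ^ (u : ℤ) * k}

theorem conj_zpow_mem {k : BaumslagGersten} (hk : k ∈ vertexGroup) {u : ℤˣ}
    (h : affine ⟨k, hk⟩ ∈ toSubgroup scalingHom.range translationHom.range u) :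
    t ^ (u : ℤ) * k * t ^ (-(u : ℤ)) ∈ vertexGroup := by
  have ht : ∀ m : ℤ, t⁻¹ * x ^ m * t = y ^ m := by
    intro m
    have := conj_zpow (i := m) (a := t⁻¹) (b := x)
    rw [inv_inv, t_inv_mul_x_mul_t] at this
    exact this.symm
  rcases Int.units_eq_one_or u with rfl | rfl
  · obtain ⟨m, hm⟩ := h
    rw [eq_zpow_y_of_affine hk (k := m.toAdd) hm.symm, ← ht]
    have : t ^ ((1 : ℤˣ) : ℤ) * (t⁻¹ * x ^ m.toAdd * t) * t ^ (-((1 : ℤˣ) : ℤ)) = x ^ m.toAdd := by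
      rw [Units.val_one]
      group
    rw [this]
    exact vertexGroup.zpow_mem x_mem _
  · obtain ⟨m, hm⟩ := h
    rw [eq_zpow_x_of_affine hk (k := m.toAdd) hm.symm]
    have : t ^ ((-1 : ℤˣ) : ℤ) * x ^ m.toAdd * t ^ (-((-1 : ℤˣ) : ℤ)) = y ^ m.toAdd := by
      rw [← ht]
      simp
    rw [this]
    exact vertexGroup.zpow_mem y_mem _

/-- A path without backtracking in the Bass–Serre tree gives a reduced word in the affine HNN
extension. -/
theorem exists_reducedWord (s : BaumslagGersten) (l : List BaumslagGersten)
    (hl : ∀ a ∈ s :: l, a ∈ steps) (hc : (s :: l).IsChain (fun a b => a * b ∉ vertexGroup)) :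
    ∃ (w : NormalWord.ReducedWord BinaryAffine scalingHom.range translationHom.range) (h k : vertexGroup)
      (u : ℤˣ) (g : BinaryAffine) (r : List (ℤˣ × BinaryAffine)),
      w.prod scalingEquivTranslation = toAffineHNN (s :: l).prod ∧
        s = h * t ^ (u : ℤ) * k ∧ w.head = affine h ∧ w.toList = (u, g) :: r := by
  induction l generalizing s with
  | nil =>
    obtain ⟨h, hh, u, k, hk, rfl⟩ := hl s (by simp)
    refine ⟨⟨affine ⟨h, hh⟩, [(u, affine ⟨k, hk⟩)], by simp⟩, ⟨h, hh⟩, ⟨k, hk⟩, u, _, _,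
      ?_, rfl, rfl, rfl⟩
    simp [NormalWord.ReducedWord.prod, of_affine, mul_assoc]
  | cons s' l ih =>
    obtain ⟨h, hh, u, k, hk, rfl⟩ := hl s (by simp)
    rw [List.isChain_cons_cons] at hc
    obtain ⟨w, h', k', u', g, r, hw, rfl, hhead, hlist⟩ :=
      ih s' (fun a ha => hl a (List.mem_cons_of_mem _ ha)) hc.2
    refine ⟨⟨affine ⟨h, hh⟩, (u, affine (⟨k, hk⟩ * h')) :: w.toList, ?_⟩, ⟨h, hh⟩, ⟨k, hk⟩, u, _, _,
      ?_, rfl, rfl, rfl⟩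
    · rw [List.isChain_cons]
      refine ⟨?_, w.chain⟩
      rintro b hb hmem
      obtain rfl : b = (u', g) := by
        rw [hlist] at hb
        simpa using hb.symm
      by_contra hne
      dsimp only at hne hmem
      obtain rfl : u' = -u := by
        rcases Int.units_eq_one_or u with rfl | rfl <;>
          rcases Int.units_eq_one_or u' with rfl | rfl <;> simp_all
      apply hc.1
      have h1 := conj_zpow_mem (⟨k, hk⟩ * h').2 hmem
      have e : h * t ^ (u : ℤ) * k * (h' * t ^ ((-u : ℤˣ) : ℤ) * k')
          = h * (t ^ (u : ℤ) * ((⟨k, hk⟩ * h' : vertexGroup) : BaumslagGersten) *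
            t ^ (-(u : ℤ))) * k' := by
        simp [mul_assoc]
      rw [e]
      exact vertexGroup.mul_mem (vertexGroup.mul_mem hh h1) k'.2
    · have e : toAffineHNN (h * t ^ (u : ℤ) * k :: (h' * t ^ (u' : ℤ) * k' :: l)).prod
          = toAffineHNN (h * t ^ (u : ℤ) * k) * w.prod scalingEquivTranslation := by
        rw [List.prod_cons, map_mul, hw]
      refine Eq.trans ?_ e.symm
      simp [NormalWord.ReducedWord.prod, of_affine, hhead, mul_assoc]

theorem toAffineHNN_mem_range {h : BaumslagGersten} (hh : h ∈ vertexGroup) :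
    toAffineHNN h ∈ (HNNExtension.of : BinaryAffine →* AffineHNN).range :=
  ⟨affine ⟨h, hh⟩, of_affine ⟨h, hh⟩⟩

/-- The Baumslag–Gersten group acts on its Bass–Serre tree. -/
theorem isBassSerre : IsBassSerre vertexGroup steps where
  mul_left := by
    rintro a ha _ ⟨h, hh, u, k, hk, rfl⟩
    exact ⟨a * h, vertexGroup.mul_mem ha hh, u, k, hk, by simp [mul_assoc]⟩
  mul_right := by
    rintro a ha _ ⟨h, hh, u, k, hk, rfl⟩
    exact ⟨h, hh, u, k * a, vertexGroup.mul_mem hk ha, by simp [mul_assoc]⟩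
  inv := by
    rintro _ ⟨h, hh, u, k, hk, rfl⟩
    exact ⟨k⁻¹, vertexGroup.inv_mem hk, -u, h⁻¹, vertexGroup.inv_mem hh, by simp [mul_assoc]⟩
  generate := by
    rw [eq_top_iff, ← closure_eq_top, Subgroup.closure_le]
    rintro _ (rfl | rfl | rfl)
    · exact Subgroup.subset_closure (Or.inl x_mem)
    · exact Subgroup.subset_closure (Or.inl y_mem)
    · exact Subgroup.subset_closure (Or.inr ⟨1, vertexGroup.one_mem, 1, 1, vertexGroup.one_mem,
        by simp⟩)
  britton := by
    intro l hne hl hc hmem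
    cases l with
    | nil => exact hne rfl
    | cons s l =>
      obtain ⟨w, -, -, u, g, r, hw, -, -, hlist⟩ := exists_reducedWord s l hl hc
      have := ReducedWord.toList_eq_nil_of_mem_of_range scalingEquivTranslation w (by
        rw [hw]
        exact toAffineHNN_mem_range hmem)
      rw [hlist] at this
      simp at this

/-- The edge stabilizers are `⟨x⟩` and `⟨y⟩`. -/
theorem affine_mem_toSubgroup {p : BaumslagGersten} (hp : p ∈ vertexGroup) {u : ℤˣ}
    (h : t ^ (u : ℤ) * p * t ^ (-(u : ℤ)) ∈ vertexGroup) :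
    affine ⟨p, hp⟩ ∈ toSubgroup scalingHom.range translationHom.range u := by
  by_contra hne
  let w : NormalWord.ReducedWord BinaryAffine scalingHom.range translationHom.range :=
    ⟨1, [(u, affine ⟨p, hp⟩), (-u, 1)], by
      rw [List.isChain_cons_cons]
      exact ⟨fun h => absurd h hne, by simp⟩⟩
  have := ReducedWord.toList_eq_nil_of_mem_of_range scalingEquivTranslation w (by
    have e : w.prod scalingEquivTranslation
        = toAffineHNN (t ^ (u : ℤ) * p * t ^ (-(u : ℤ))) := by
      simp [w, NormalWord.ReducedWord.prod, of_affine, mul_assoc]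
    rw [e]
    exact toAffineHNN_mem_range h)
  simp [w] at this

theorem exists_zpow_x_of_conj_t {p : BaumslagGersten} (hp : p ∈ vertexGroup)
    (h : t⁻¹ * p * t ∈ vertexGroup) : ∃ m : ℤ, p = x ^ m := by
  obtain ⟨m, hm⟩ := affine_mem_toSubgroup hp (u := -1) (by simpa using h)
  exact ⟨m.toAdd, eq_zpow_x_of_affine hp hm.symm⟩

theorem exists_zpow_y_of_conj_t_inv {p : BaumslagGersten} (hp : p ∈ vertexGroup)
    (h : t * p * t⁻¹ ∈ vertexGroup) : ∃ m : ℤ, p = y ^ m := by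
  obtain ⟨m, hm⟩ := affine_mem_toSubgroup hp (u := 1) (by simpa using h)
  exact ⟨m.toAdd, eq_zpow_y_of_affine hp hm.symm⟩

end BaumslagGersten

/-! ### Fixed vertices and normalizers -/

namespace BaumslagGersten

open BinaryAffine

theorem affine_conj_n (h g : vertexGroup) : (affine (h⁻¹ * g * h)).n = (affine g).n := by
  rw [map_mul, map_mul, map_inv]
  simp

theorem affine_conj_zpow_x (h : vertexGroup) (a : ℤ) :
    affine (h⁻¹ * ⟨x, x_mem⟩ ^ a * h) = translation (2 ^ (affine h).n * a) := by
  rw [map_mul, map_mul, map_inv, affine_zpow_x]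
  ext
  · simp
  · simp

theorem conj_zpow_x_eq_zpow_x {h : BaumslagGersten} (hh : h ∈ vertexGroup) {a b : ℤ}
    (e : h⁻¹ * x ^ a * h = x ^ b) : (2 : ℚ) ^ (affine ⟨h, hh⟩).n * a = b := by
  have e' : (⟨h, hh⟩⁻¹ * ⟨x, x_mem⟩ ^ a * ⟨h, hh⟩ : vertexGroup) = ⟨x, x_mem⟩ ^ b :=
    Subtype.ext (by simpa using e)
  have := congrArg affine e'
  rw [affine_conj_zpow_x, affine_zpow_x] at this
  exact congrArg BinaryAffine.b this

theorem conj_zpow_x_ne_zpow_y {h : BaumslagGersten} (hh : h ∈ vertexGroup) {a b : ℤ}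
    (ha : a ≠ 0) : h⁻¹ * x ^ a * h ≠ y ^ b := by
  intro e
  have e' : (⟨h, hh⟩⁻¹ * ⟨x, x_mem⟩ ^ a * ⟨h, hh⟩ : vertexGroup) = ⟨y, y_mem⟩ ^ b :=
    Subtype.ext (by simpa using e)
  have := congrArg affine e'
  rw [affine_conj_zpow_x, affine_zpow_y] at this
  have hb := congrArg BinaryAffine.b this
  have : (2 : ℚ) ^ (affine ⟨h, hh⟩).n ≠ 0 := by positivity
  simp [this, ha] at hb

theorem conj_zpow_y_ne_zpow_x {h : BaumslagGersten} (hh : h ∈ vertexGroup) {a b : ℤ}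
    (ha : a ≠ 0) : h⁻¹ * y ^ a * h ≠ x ^ b := by
  intro e
  have e' : (⟨h, hh⟩⁻¹ * ⟨y, y_mem⟩ ^ a * ⟨h, hh⟩ : vertexGroup) = ⟨x, x_mem⟩ ^ b :=
    Subtype.ext (by simpa using e)
  have := congrArg (fun g => (affine g).n) e'
  simp only [affine_conj_n, affine_zpow_x, affine_zpow_y] at this
  exact ha this

/-- For `a ≠ 0` the normalizer of `⟨y ^ a⟩` in the vertex group is `⟨y⟩`. -/
theorem exists_zpow_y_of_conj_zpow_y {h : BaumslagGersten} (hh : h ∈ vertexGroup) {a b : ℤ}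
    (ha : a ≠ 0) (e : h⁻¹ * y ^ a * h = y ^ b) : ∃ n : ℤ, h = y ^ n := by
  have e' : (⟨y, y_mem⟩ ^ a * ⟨h, hh⟩ : vertexGroup) = ⟨h, hh⟩ * ⟨y, y_mem⟩ ^ b := by
    apply Subtype.ext
    rw [mul_assoc, inv_mul_eq_iff_eq_mul] at e
    simpa using e
  have e'' := congrArg affine e'
  rw [map_mul, map_mul, affine_zpow_y, affine_zpow_y] at e''
  have hb := congrArg BinaryAffine.b e''
  simp only [mul_b, scaling_b, scaling_n, zero_add, mul_zero, add_zero] at hb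
  refine ⟨(affine ⟨h, hh⟩).n, eq_zpow_y_of_affine hh ?_⟩
  ext
  · rfl
  · by_contra hne
    rw [scaling_b] at hne
    have h1 : (2 : ℚ) ^ (-a) = 1 := by
      apply mul_right_cancel₀ hne
      rw [hb, one_mul]
    have h2 : (2 : ℚ) ^ (-a) = 2 ^ (0 : ℤ) := by simpa using h1
    have h3 := zpow_right_injective₀ (a := (2 : ℚ)) (by norm_num) (by norm_num) h2
    omega

theorem x_mul_y_ne : x * y ≠ y * x := by
  intro e
  have e' : (⟨x, x_mem⟩ * ⟨y, y_mem⟩ : vertexGroup) = ⟨y, y_mem⟩ * ⟨x, x_mem⟩ := Subtype.ext e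
  have := congrArg BinaryAffine.b (congrArg affine e')
  rw [map_mul, map_mul, affine_x, affine_y] at this
  norm_num at this

theorem mem_steps_of_treeDist_eq_one {p : BaumslagGersten}
    (hp : treeDist vertexGroup steps 1 p = 1) : p ∈ steps := by
  have hp' : treeLength vertexGroup steps p = 1 := by simpa [treeDist] using hp
  obtain ⟨s, hs, h⟩ := isBassSerre.exists_first_step (g := p) (by omega)
  have hmem := isBassSerre.treeLength_eq_zero_iff.1
    (show treeLength vertexGroup steps (s⁻¹ * p) = 0 by omega)
  simpa using isBassSerre.mul_right _ hmem s hs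

theorem treeDist_one_smul_eq_zero {r : BaumslagGersten} (hr : r ∈ vertexGroup) :
    treeDist vertexGroup steps 1 (r * 1) = 0 := by
  rw [isBassSerre.treeDist_eq_zero_iff]
  simpa using hr

theorem treeDist_smul_eq_zero_iff {r k : BaumslagGersten} :
    treeDist vertexGroup steps k (r * k) = 0 ↔ k⁻¹ * r * k ∈ vertexGroup := by
  rw [isBassSerre.treeDist_eq_zero_iff, mul_assoc]

/-- On the way to a vertex `kH` other than `H` there is a neighbour of `H`, which is fixed by all
elements of `H` fixing `kH`. -/
theorem exists_neighbour {k : BaumslagGersten} (hk : k ∉ vertexGroup) :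
    ∃ h ∈ vertexGroup, ∃ u : ℤˣ,
      treeDist vertexGroup steps (h * t ^ (u : ℤ)) k + 1 = treeDist vertexGroup steps 1 k ∧
      ∀ r ∈ vertexGroup, k⁻¹ * r * k ∈ vertexGroup →
        (h * t ^ (u : ℤ))⁻¹ * r * (h * t ^ (u : ℤ)) ∈ vertexGroup := by
  have hne : treeDist vertexGroup steps 1 k ≠ 0 := by
    rw [Ne, isBassSerre.treeDist_eq_zero_iff]
    simpa using hk
  obtain ⟨p, hp, hpk⟩ := isBassSerre.exists_treeDist_eq 1 k (n := 1) (by omega)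
  obtain ⟨h, hh, u, c, hc, rfl⟩ := mem_steps_of_treeDist_eq_one hp
  refine ⟨h, hh, u, ?_, ?_⟩
  · rw [← hpk, treeDist, treeDist, mul_inv_rev _ c, mul_assoc c⁻¹,
      isBassSerre.treeLength_mul_left (vertexGroup.inv_mem hc)]
  · intro r hr hrk
    have := isBassSerre.fixes_of_between (p := h * t ^ (u : ℤ) * c) (by omega)
      (treeDist_one_smul_eq_zero hr) (treeDist_smul_eq_zero_iff.2 hrk)
    rw [treeDist_smul_eq_zero_iff] at this
    have h2 := vertexGroup.mul_mem (vertexGroup.mul_mem hc this) (vertexGroup.inv_mem hc)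
    have e : c * ((h * t ^ (u : ℤ) * c)⁻¹ * r * (h * t ^ (u : ℤ) * c)) * c⁻¹
        = (h * t ^ (u : ℤ))⁻¹ * r * (h * t ^ (u : ℤ)) := by group
    rwa [e] at h2

/-- The vertex group fixes no vertex but its own, since the edge groups are abelian. -/
theorem mem_vertexGroup_of_conj_mem {k : BaumslagGersten} (hx : k⁻¹ * x * k ∈ vertexGroup)
    (hy : k⁻¹ * y * k ∈ vertexGroup) : k ∈ vertexGroup := by
  by_contra hk
  obtain ⟨h, hh, u, -, hfix⟩ := exists_neighbour hk
  have hconj : ∀ r ∈ vertexGroup, h⁻¹ * r * h ∈ vertexGroup := fun r hr =>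
    vertexGroup.mul_mem (vertexGroup.mul_mem (vertexGroup.inv_mem hh) hr) hh
  have hcomm : ∀ a b : BaumslagGersten, h⁻¹ * x * h = a → h⁻¹ * y * h = b →
      a * b = b * a → False := by
    rintro a b rfl rfl hab
    apply x_mul_y_ne
    have e1 : h⁻¹ * x * h * (h⁻¹ * y * h) = h⁻¹ * (x * y) * h := by group
    have e2 : h⁻¹ * y * h * (h⁻¹ * x * h) = h⁻¹ * (y * x) * h := by group
    rw [e1, e2] at hab
    exact mul_left_cancel (mul_right_cancel hab)
  have h1 := hfix x x_mem hx
  have h2 := hfix y y_mem hy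
  rcases Int.units_eq_one_or u with rfl | rfl
  · obtain ⟨m, hm⟩ := exists_zpow_x_of_conj_t (hconj x x_mem) (by simpa [mul_assoc] using h1)
    obtain ⟨n, hn⟩ := exists_zpow_x_of_conj_t (hconj y y_mem) (by simpa [mul_assoc] using h2)
    exact hcomm _ _ hm hn (by rw [← zpow_add, ← zpow_add, add_comm])
  · obtain ⟨m, hm⟩ := exists_zpow_y_of_conj_t_inv (hconj x x_mem) (by simpa [mul_assoc] using h1)
    obtain ⟨n, hn⟩ := exists_zpow_y_of_conj_t_inv (hconj y y_mem) (by simpa [mul_assoc] using h2)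
    exact hcomm _ _ hm hn (by rw [← zpow_add, ← zpow_add, add_comm])

/-- An element `g` conjugating `x` to a power of `x` lies in the vertex group. The vertices fixed by
`x` are `H` itself and neighbours `htH` of `H`, and `(h * t)⁻¹ * x * (h * t)` is a nontrivial power
of `y`, which is not conjugate in `H` to a power of `x`; hence `gH = H`. -/
theorem mem_vertexGroup_of_conj_x {g : BaumslagGersten} {e : ℤ} (hg : g⁻¹ * x * g = x ^ e) :
    g ∈ vertexGroup := by
  by_contra hgV
  obtain ⟨h, hh, u, hdist, hfix⟩ := exists_neighbour hgV
  have h1 := hfix x x_mem (by rw [hg]; exact vertexGroup.zpow_mem x_mem _)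
  have hconj : h⁻¹ * x * h ∈ vertexGroup :=
    vertexGroup.mul_mem (vertexGroup.mul_mem (vertexGroup.inv_mem hh) x_mem) hh
  rcases Int.units_eq_one_or u with rfl | rfl
  · obtain ⟨m, hm⟩ := exists_zpow_x_of_conj_t hconj (by simpa [mul_assoc] using h1)
    have hm0 : m ≠ 0 := by
      rintro rfl
      have := conj_zpow_x_eq_zpow_x hh (a := 1) (b := 0) (by simpa using hm)
      have h2 : (2 : ℚ) ^ (affine ⟨h, hh⟩).n ≠ 0 := by positivity
      simp [h2] at this
    have hy : (h * t)⁻¹ * x * (h * t) = y ^ m := by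
      have := conj_zpow (i := m) (a := t⁻¹) (b := x)
      rw [inv_inv, t_inv_mul_x_mul_t, ← hm] at this
      rw [this]
      group
    set g' := (h * t)⁻¹ * g with hg'
    have hgy : g'⁻¹ * y ^ m * g' = x ^ e := by
      rw [← hy, ← hg, hg']
      group
    have hdist' : treeDist vertexGroup steps 1 g' + 1 = treeDist vertexGroup steps 1 g := by
      rw [← hdist, hg']
      simp [treeDist]
    by_cases hgV' : g' ∈ vertexGroup
    · exact conj_zpow_y_ne_zpow_x hgV' hm0 hgy
    · obtain ⟨k, hk, v, hdist2, hfix2⟩ := exists_neighbour hgV'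
      have h2 := hfix2 (y ^ m) (vertexGroup.zpow_mem y_mem _)
        (by rw [hgy]; exact vertexGroup.zpow_mem x_mem _)
      have hconj2 : k⁻¹ * y ^ m * k ∈ vertexGroup :=
        vertexGroup.mul_mem (vertexGroup.mul_mem (vertexGroup.inv_mem hk)
          (vertexGroup.zpow_mem y_mem _)) hk
      rcases Int.units_eq_one_or v with rfl | rfl
      · obtain ⟨l, hl⟩ := exists_zpow_x_of_conj_t hconj2 (by simpa [mul_assoc] using h2)
        exact conj_zpow_y_ne_zpow_x hk hm0 hl
      · obtain ⟨l, hl⟩ := exists_zpow_y_of_conj_t_inv hconj2 (by simpa [mul_assoc] using h2)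
        obtain ⟨n, rfl⟩ := exists_zpow_y_of_conj_zpow_y hk hm0 hl
        -- The second edge would lead back to `H`.
        have hback : h * t * (y ^ n * t ^ (((-1 : ℤˣ) : ℤˣ) : ℤ)) ∈ vertexGroup := by
          have := conj_zpow (i := n) (a := t⁻¹) (b := x)
          rw [inv_inv, t_inv_mul_x_mul_t] at this
          rw [this]
          have e : h * t * (t⁻¹ * x ^ n * t * t ^ (((-1 : ℤˣ) : ℤˣ) : ℤ)) = h * x ^ n := by
            simp [mul_assoc]
          rw [e]
          exact vertexGroup.mul_mem hh (vertexGroup.zpow_mem x_mem _)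
        have e3 : treeDist vertexGroup steps (y ^ n * t ^ (((-1 : ℤˣ) : ℤˣ) : ℤ)) g'
            = treeDist vertexGroup steps 1 g := by
          rw [treeDist, treeDist, hg', inv_one, one_mul,
            ← isBassSerre.treeLength_mul_left (vertexGroup.inv_mem hback) g]
          congr 1
          group
        omega
  · obtain ⟨m, hm⟩ := exists_zpow_y_of_conj_t_inv hconj (by simpa [mul_assoc] using h1)
    exact conj_zpow_x_ne_zpow_y hh one_ne_zero (by simpa using hm)

end BaumslagGersten

/-! ### The twist automorphisms -/

namespace BaumslagGersten

open BinaryAffine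

theorem exists_affine_eq_translation (d : Multiplicative dyadicRationals) :
    ∃ h : vertexGroup, affine h = translation (d.toAdd : ℚ) :=
  exists_affine_eq 0 d.toAdd.2

/-- The translation `q ↦ q + d` by a dyadic rational `d`, as an element of the vertex group. -/
noncomputable def dyadicTranslation : Multiplicative dyadicRationals →* vertexGroup where
  toFun d := (exists_affine_eq_translation d).choose
  map_one' := affine_injective <| by
    rw [(exists_affine_eq_translation 1).choose_spec, map_one affine]
    rfl
  map_mul' c d := affine_injective <| by
    rw [(exists_affine_eq_translation (c * d)).choose_spec, map_mul affine,
      (exists_affine_eq_translation c).choose_spec, (exists_affine_eq_translation d).choose_spec,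
      ← translation_add]
    rfl

theorem affine_dyadicTranslation (d : Multiplicative dyadicRationals) :
    affine (dyadicTranslation d) = translation (d.toAdd : ℚ) :=
  (exists_affine_eq_translation d).choose_spec

theorem exists_dyadicTranslation {h : vertexGroup} (hn : (affine h).n = 0) :
    ∃ d, h = dyadicTranslation d := by
  refine ⟨Multiplicative.ofAdd ⟨(affine h).b, affine_b_mem h⟩, affine_injective ?_⟩
  rw [affine_dyadicTranslation]
  ext
  · exact hn
  · rfl

theorem x_mul_dyadicTranslation (d : Multiplicative dyadicRationals) :
    x * (dyadicTranslation d : BaumslagGersten) = dyadicTranslation d * x := by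
  have : (⟨x, x_mem⟩ * dyadicTranslation d : vertexGroup) = dyadicTranslation d * ⟨x, x_mem⟩ := by
    apply affine_injective
    rw [map_mul, map_mul, affine_x, affine_dyadicTranslation, ← translation_add, add_comm,
      translation_add]
  exact congrArg Subtype.val this

/-- The endomorphism fixing `x` and `y` and sending `t` to `n t`, where `n` is the translation
by `d`; it exists because `n` centralizes `x`. -/
noncomputable def twistHom (d : Multiplicative dyadicRationals) :
    BaumslagGersten →* BaumslagGersten :=
  PresentedGroup.toGroup (f := fun g => match g with
    | .x => x
    | .y => y
    | .t => dyadicTranslation d * t) <| by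
  apply relators_eq_one
  · exact y_inv_mul_x_mul_y
  · dsimp only
    have e : ((dyadicTranslation d : BaumslagGersten) * t)⁻¹ * x * (dyadicTranslation d * t)
        = t⁻¹ * ((dyadicTranslation d : BaumslagGersten)⁻¹ * (x * dyadicTranslation d)) * t := by
      group
    rw [e, x_mul_dyadicTranslation, inv_mul_cancel_left, t_inv_mul_x_mul_t]

@[simp] theorem twistHom_x (d : Multiplicative dyadicRationals) : twistHom d x = x :=
  PresentedGroup.toGroup.of _
@[simp] theorem twistHom_y (d : Multiplicative dyadicRationals) : twistHom d y = y :=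
  PresentedGroup.toGroup.of _
@[simp] theorem twistHom_t (d : Multiplicative dyadicRationals) :
    twistHom d t = dyadicTranslation d * t :=
  PresentedGroup.toGroup.of _

theorem twistHom_of_mem (d : Multiplicative dyadicRationals) {h : BaumslagGersten}
    (hh : h ∈ vertexGroup) : twistHom d h = h := by
  have : vertexGroup ≤ (twistHom d).eqLocus (MonoidHom.id _) := by
    rw [vertexGroup, Subgroup.closure_le]
    rintro _ (rfl | rfl)
    · exact twistHom_x d
    · exact twistHom_y d
  exact this hh

theorem twistHom_mul (c d : Multiplicative dyadicRationals) :
    twistHom (c * d) = (twistHom c).comp (twistHom d) := by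
  apply hom_ext
  · simp
  · simp
  · rw [mul_comm c d]
    simp [twistHom_of_mem, mul_assoc]

theorem twistHom_one : twistHom 1 = MonoidHom.id _ := by
  apply hom_ext <;> simp

/-- The action of the dyadic rationals by twists. -/
noncomputable def twist : Multiplicative dyadicRationals →* MulAut BaumslagGersten where
  toFun d := MonoidHom.toMulEquiv (twistHom d) (twistHom d⁻¹)
    (by rw [← twistHom_mul, inv_mul_cancel, twistHom_one])
    (by rw [← twistHom_mul, mul_inv_cancel, twistHom_one])
  map_one' := by
    ext g
    simp [twistHom_one]
  map_mul' c d := by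
    ext g
    simp [twistHom_mul]

@[simp] theorem twist_apply (d : Multiplicative dyadicRationals) (g : BaumslagGersten) :
    twist d g = twistHom d g := rfl

/-- The action of the dyadic rationals by twists, modulo inner automorphisms. -/
noncomputable def outerTwist : Multiplicative dyadicRationals →* Out BaumslagGersten :=
  (QuotientGroup.mk' (Inn BaumslagGersten)).comp twist

/-- The vertex group has trivial centralizer. -/
theorem eq_one_of_commute {g : BaumslagGersten} (hx : g * x * g⁻¹ = x) (hy : g * y * g⁻¹ = y) :
    g = 1 := by
  have hx' : g⁻¹ * x * g = x := by
    conv_lhs => rw [← hx]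
    group
  have hy' : g⁻¹ * y * g = y := by
    conv_lhs => rw [← hy]
    group
  have hg : g ∈ vertexGroup :=
    mem_vertexGroup_of_conj_mem (by rw [hx']; exact x_mem) (by rw [hy']; exact y_mem)
  obtain ⟨n, rfl⟩ := exists_zpow_y_of_conj_zpow_y hg (a := 1) (b := 1) one_ne_zero
    (by simpa using hy')
  have h := conj_zpow_x_eq_zpow_x hg (a := 1) (b := 1) (by simpa using hx')
  have e : affine ⟨y ^ n, hg⟩ = scaling n := affine_zpow_y n
  rw [e, scaling_n, Int.cast_one, mul_one] at h
  have h3 := zpow_right_injective₀ (a := (2 : ℚ)) (by norm_num) (by norm_num)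
    (h.trans (zpow_zero (2 : ℚ)).symm)
  rw [h3, zpow_zero]

theorem outerTwist_injective : Function.Injective outerTwist := by
  rw [injective_iff_map_eq_one]
  intro d hd
  obtain ⟨g, hg⟩ := (QuotientGroup.eq_one_iff _).1 hd
  have happ : ∀ z, g * z * g⁻¹ = twistHom d z := fun z => by
    rw [← twist_apply, ← hg, MulAut.conj_apply]
  have hg1 : g = 1 :=
    eq_one_of_commute ((happ x).trans (twistHom_x d)) ((happ y).trans (twistHom_y d))
  have ht := happ t
  rw [hg1, twistHom_t, one_mul, inv_one, mul_one, right_eq_mul] at ht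
  have h1 : dyadicTranslation d = 1 := Subtype.ext ht
  have h2 := affine_dyadicTranslation d
  rw [h1, map_one] at h2
  have h3 := congrArg BinaryAffine.b h2
  rw [one_b, translation_b] at h3
  exact Multiplicative.toAdd.injective (Subtype.ext h3.symm)

/-! ### Normalizing an automorphism -/

theorem conj_x_y (ψ : MulAut BaumslagGersten) : (ψ y)⁻¹ * ψ x * ψ y = ψ x ^ 2 := by
  rw [← map_inv, ← map_mul, ← map_mul, ← map_pow, y_inv_mul_x_mul_y]

theorem conj_x_t (ψ : MulAut BaumslagGersten) : (ψ t)⁻¹ * ψ x * ψ t = ψ y := by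
  rw [← map_inv, ← map_mul, ← map_mul, t_inv_mul_x_mul_t]

/-- Each automorphism carries the vertex group into a conjugate of itself. -/
theorem exists_conj_mem (ψ : MulAut BaumslagGersten) :
    ∃ g : BaumslagGersten, ∀ h ∈ vertexGroup, (MulAut.conj g * ψ) h ∈ vertexGroup := by
  obtain ⟨k, hx, hy⟩ := isBassSerre.exists_common_fixed (conj_x_y ψ) (conj_x_t ψ)
  refine ⟨k⁻¹, ?_⟩
  have : vertexGroup ≤ vertexGroup.comap (MulAut.conj k⁻¹ * ψ).toMonoidHom := by
    conv_lhs => rw [vertexGroup]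
    rw [Subgroup.closure_le]
    rintro _ (rfl | rfl)
    · simpa using hx
    · simpa using hy
  exact fun h hh => this hh

/-- Each automorphism carries the vertex group onto a conjugate of itself. -/
theorem exists_conj_mem_iff (ψ : MulAut BaumslagGersten) :
    ∃ g : BaumslagGersten, ∀ h, (MulAut.conj g * ψ) h ∈ vertexGroup ↔ h ∈ vertexGroup := by
  obtain ⟨g, hg⟩ := exists_conj_mem ψ
  refine ⟨g, fun h => ⟨fun hh => ?_, hg h⟩⟩
  obtain ⟨k, hk⟩ := exists_conj_mem (MulAut.conj g * ψ)⁻¹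
  have hk' : ∀ z, (MulAut.conj g * ψ) z ∈ vertexGroup → k * z * k⁻¹ ∈ vertexGroup := by
    intro z hz
    have := hk _ hz
    rwa [MulAut.mul_apply, MulAut.inv_apply_self, MulAut.conj_apply] at this
  have hkV : k⁻¹ ∈ vertexGroup := mem_vertexGroup_of_conj_mem
    (by simpa using hk' x (hg x x_mem)) (by simpa using hk' y (hg y y_mem))
  have := vertexGroup.mul_mem (vertexGroup.mul_mem hkV (hk' h hh)) (vertexGroup.inv_mem hkV)
  simpa [mul_assoc] using this

/-- The units of the ring of dyadic rationals are the `± 2ʳ`. -/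
theorem exists_eq_two_zpow {u : ℚ} (hu : u ∈ dyadicRationals) {a : ℤ} {i : ℕ}
    (h : a * u = 2 ^ i) : ∃ r : ℤ, u = 2 ^ r ∨ u = -2 ^ r := by
  obtain ⟨b, k, rfl⟩ := mem_dyadicRationals_iff.1 hu
  have hab : a * b = 2 ^ (i + k) := by
    have : (a : ℚ) * b = 2 ^ (i + k) := by
      rw [pow_add, ← h]
      field_simp
    exact_mod_cast this
  have hdvd : b.natAbs ∣ 2 ^ (i + k) := by
    refine ⟨a.natAbs, ?_⟩
    rw [← Int.natAbs_mul, mul_comm, hab, Int.natAbs_pow]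
    rfl
  obtain ⟨l, -, hl⟩ := (Nat.dvd_prime_pow Nat.prime_two).1 hdvd
  refine ⟨l - k, ?_⟩
  rw [zpow_sub₀ (two_ne_zero' ℚ), zpow_natCast, zpow_natCast]
  rcases Int.natAbs_eq b with hb | hb
  · left
    rw [hb, hl]
    simp
  · right
    rw [hb, hl]
    push_cast
    ring

/-- An automorphism preserving the vertex group restricts to an automorphism of `BS(1, 2)`, so it
multiplies the translation part by a unit `± 2ʳ` and preserves the scaling part. -/
theorem affine_map_generators {ψ : MulAut BaumslagGersten}
    (hψ : ∀ h, ψ h ∈ vertexGroup ↔ h ∈ vertexGroup) (hX : ψ x ∈ vertexGroup)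
    (hY : ψ y ∈ vertexGroup) :
    (∃ r : ℤ, affine ⟨ψ x, hX⟩ = translation (2 ^ r) ∨
      affine ⟨ψ x, hX⟩ = translation (-2 ^ r)) ∧ (affine ⟨ψ y, hY⟩).n = 1 := by
  set p := affine ⟨ψ x, hX⟩ with hp
  set q := affine ⟨ψ y, hY⟩ with hq
  have hrel : q⁻¹ * p * q = p ^ 2 := by
    have e : (⟨ψ y, hY⟩⁻¹ * ⟨ψ x, hX⟩ * ⟨ψ y, hY⟩ : vertexGroup) = ⟨ψ x, hX⟩ ^ 2 :=
      Subtype.ext (by simpa using conj_x_y ψ)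
    have e' := congrArg affine e
    rwa [map_mul, map_mul, map_inv, map_pow] at e'
  have hpn : p.n = 0 := by
    have := congrArg BinaryAffine.n hrel
    simp [pow_two] at this
    omega
  have hp_eq : p = translation p.b := by
    ext
    · exact hpn
    · rfl
  have hx1 : x ≠ 1 := by
    intro h
    exact x_mul_y_ne (by simp [h])
  have hpb : p.b ≠ 0 := by
    intro h0
    rw [h0] at hp_eq
    have : ψ x = x ^ (0 : ℤ) := eq_zpow_x_of_affine hX (by rw [← hp, hp_eq]; simp)
    rw [zpow_zero, map_eq_one_iff _ ψ.injective] at this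
    exact hx1 this
  have hqn : q.n = 1 := by
    have h1 := congrArg BinaryAffine.b hrel
    rw [hp_eq] at h1
    simp [pow_two] at h1
    have h2 : (2 : ℚ) ^ q.n = 2 ^ (1 : ℤ) := by
      apply mul_right_cancel₀ hpb
      rw [zpow_one]
      linarith
    exact zpow_right_injective₀ (a := (2 : ℚ)) (by norm_num) (by norm_num) h2
  refine ⟨?_, hqn⟩
  -- As `x` lies in the group generated by `ψ x` and `ψ y`, the translation part of `ψ x` is a unit.
  obtain ⟨z, hz⟩ := ψ.surjective x
  have hzV : z ∈ vertexGroup := (hψ z).1 (by rw [hz]; exact x_mem)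
  obtain ⟨i, j, a, hija⟩ := exists_normalForm y_inv_mul_x_mul_y hzV
  have e : (⟨x, x_mem⟩ * ⟨ψ y, hY⟩ ^ j : vertexGroup) = ⟨ψ y, hY⟩ ^ i * ⟨ψ x, hX⟩ ^ a := by
    apply Subtype.ext
    have h1 : x = ψ y ^ i * ψ x ^ a * (ψ y)⁻¹ ^ j := by
      have h := congrArg ψ hija
      rw [hz] at h
      simpa using h
    have h2 : x * ψ y ^ j = ψ y ^ i * ψ x ^ a := by
      conv_lhs => rw [h1]
      simp
    simpa using h2
  have e' := congrArg affine e
  rw [map_mul, map_mul, map_pow, map_pow, map_zpow, ← hp, ← hq, affine_x, hp_eq,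
    translation_zpow] at e'
  have hn := congrArg BinaryAffine.n e'
  simp [pow_n, hqn] at hn
  subst hn
  have hb := congrArg BinaryAffine.b e'
  simp [pow_n, hqn] at hb
  have hu : p.b ∈ dyadicRationals := affine_b_mem _
  obtain ⟨r, hr⟩ := exists_eq_two_zpow (a := a) (i := j) hu (by
    have h2 : (2 : ℚ) ^ j ≠ 0 := by positivity
    field_simp at hb
    linarith)
  refine ⟨r, ?_⟩
  rcases hr with hr | hr
  · left
    rw [hp_eq, hr]
  · right
    rw [hp_eq, hr]

/-- Up to an inner automorphism, an automorphism fixes `y` and sends `x` to `x` or `x⁻¹`. -/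
theorem exists_conj_generators (ψ : MulAut BaumslagGersten) :
    ∃ (g : BaumslagGersten) (e : ℤ), (e = 1 ∨ e = -1) ∧ (MulAut.conj g * ψ) x = x ^ e ∧
      (MulAut.conj g * ψ) y = y := by
  obtain ⟨g, hg⟩ := exists_conj_mem_iff ψ
  set φ := MulAut.conj g * ψ with hφ
  have hX : φ x ∈ vertexGroup := (hg x).2 x_mem
  have hY : φ y ∈ vertexGroup := (hg y).2 y_mem
  obtain ⟨⟨r, hr⟩, hqn⟩ := affine_map_generators hg hX hY
  obtain ⟨e, he, hr⟩ : ∃ e : ℤ, (e = 1 ∨ e = -1) ∧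
      affine ⟨φ x, hX⟩ = translation (2 ^ r * e) := by
    rcases hr with hr | hr
    · exact ⟨1, Or.inl rfl, by simpa using hr⟩
    · exact ⟨-1, Or.inr rfl, by simpa using hr⟩
  set c := (affine ⟨φ y, hY⟩).b with hc
  have hcD : c ∈ dyadicRationals := affine_b_mem _
  -- The map `q ↦ 2⁻ʳ (q - 2c)` takes the fixed point `2c` of `φ y` to `0`.
  obtain ⟨h, hh⟩ := exists_affine_eq r (dyadicRationals.neg_mem (two_zpow_mul_mem hcD (1 - r)))
  have h2r : (2 : ℚ) ^ r ≠ 0 := by positivity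
  refine ⟨h * g, e, he, ?_, ?_⟩
  · rw [map_mul, mul_assoc, ← hφ, MulAut.mul_apply, MulAut.conj_apply]
    refine eq_zpow_x_of_affine (vertexGroup.mul_mem (vertexGroup.mul_mem h.2 hX)
      (vertexGroup.inv_mem h.2)) ?_
    change affine (h * ⟨φ x, hX⟩ * h⁻¹) = _
    rw [map_mul, map_mul, map_inv, hh, hr]
    ext
    · simp
    · simp
      field_simp
      ring
  · rw [map_mul, mul_assoc, ← hφ, MulAut.mul_apply, MulAut.conj_apply]
    have : affine (h * ⟨φ y, hY⟩ * h⁻¹) = scaling 1 := by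
      rw [map_mul, map_mul, map_inv, hh]
      ext
      · simp [hqn]
      · simp [hqn, ← hc, zpow_add₀, zpow_sub₀]
        field_simp
        ring
    have h1 := eq_zpow_y_of_affine (h * ⟨φ y, hY⟩ * h⁻¹).2 this
    simpa using h1

theorem outerTwist_surjective : Function.Surjective outerTwist := by
  intro o
  obtain ⟨ψ, rfl⟩ := QuotientGroup.mk'_surjective (Inn BaumslagGersten) o
  obtain ⟨g, e, he, hx, hy⟩ := exists_conj_generators ψ
  have hconj : QuotientGroup.mk' (Inn BaumslagGersten) (MulAut.conj g) = 1 :=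
    (QuotientGroup.eq_one_iff _).2 ⟨g, rfl⟩
  have hmk : QuotientGroup.mk' (Inn BaumslagGersten) (MulAut.conj g * ψ)
      = QuotientGroup.mk' (Inn BaumslagGersten) ψ := by
    rw [map_mul, hconj, one_mul]
  rw [← hmk]
  set φ := MulAut.conj g * ψ with hφ
  have ht := conj_x_t φ
  rw [hx, hy] at ht
  -- `t (φ t)⁻¹` conjugates `x` to `x ^ e`.
  have hk : (t * (φ t)⁻¹)⁻¹ * x * (t * (φ t)⁻¹) = x ^ e := by
    have e1 : (t * (φ t)⁻¹)⁻¹ * x * (t * (φ t)⁻¹) = φ t * (t⁻¹ * x * t) * (φ t)⁻¹ := by group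
    rw [e1, t_inv_mul_x_mul_t, ← ht]
    group
  have hkV := mem_vertexGroup_of_conj_x hk
  have hpow := conj_zpow_x_eq_zpow_x hkV (a := 1) (b := e) (by simpa using hk)
  rw [Int.cast_one, mul_one] at hpow
  have hpos : (0 : ℚ) < 2 ^ (affine ⟨t * (φ t)⁻¹, hkV⟩).n := by positivity
  have he1 : e = 1 := by
    rcases he with he | he
    · exact he
    · rw [hpow, he] at hpos
      norm_num at hpos
  subst he1
  have hn := zpow_right_injective₀ (a := (2 : ℚ)) (by norm_num) (by norm_num)
    (hpow.trans (show ((1 : ℤ) : ℚ) = 2 ^ (0 : ℤ) by simp))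
  obtain ⟨d, hd⟩ := exists_dyadicTranslation hn
  refine ⟨d⁻¹, ?_⟩
  rw [outerTwist, MonoidHom.comp_apply]
  congr 1
  apply MulEquiv.toMonoidHom_injective
  apply hom_ext
  · change twistHom d⁻¹ x = φ x
    rw [twistHom_x, hx, zpow_one]
  · change twistHom d⁻¹ y = φ y
    rw [twistHom_y, hy]
  · change twistHom d⁻¹ t = φ t
    have h1 : t * (φ t)⁻¹ = dyadicTranslation d := congrArg Subtype.val hd
    rw [twistHom_t, map_inv, Subgroup.coe_inv, ← h1]
    group

end BaumslagGersten

/-! ### The dyadic rationals are not finitely generated -/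

/-- Finitely many dyadic rationals have a common denominator, which the group they generate
shares. -/
theorem dyadicRationals_not_fg : ¬ AddGroup.FG dyadicRationals := by
  intro h
  obtain ⟨T, hT⟩ := h.out
  choose a n han using fun q : dyadicRationals => BaumslagGersten.mem_dyadicRationals_iff.1 q.2
  let K : AddSubgroup dyadicRationals :=
    (AddSubgroup.zmultiples ((1 : ℚ) / 2 ^ T.sup n)).comap dyadicRationals.subtype
  have hK : (⊤ : AddSubgroup dyadicRationals) ≤ K := by
    rw [← hT, AddSubgroup.closure_le]
    intro q hq
    refine AddSubgroup.mem_zmultiples_iff.2 ⟨a q * 2 ^ (T.sup n - n q), ?_⟩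
    have hle : n q ≤ T.sup n := Finset.le_sup hq
    have e : (2 : ℚ) ^ T.sup n = 2 ^ (T.sup n - n q) * 2 ^ n q := by
      rw [← pow_add, Nat.sub_add_cancel hle]
    rw [zsmul_eq_mul, e, AddSubgroup.coe_subtype, han q]
    push_cast
    field_simp
  have hmem : (⟨1 / 2 ^ (T.sup n + 1), AddSubgroup.subset_closure ⟨_, rfl⟩⟩ : dyadicRationals) ∈ K :=
    hK trivial
  obtain ⟨m, hm⟩ := AddSubgroup.mem_zmultiples_iff.1 hmem
  have hm : (m : ℚ) * (1 / 2 ^ T.sup n) = 1 / (2 ^ T.sup n * 2) := by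
    rw [← pow_succ, ← zsmul_eq_mul]
    exact hm
  field_simp at hm
  have : m * 2 = 1 := by exact_mod_cast hm
  omega

theorem theorem1 :
    Nonempty (Out BaumslagGersten ≃* Multiplicative dyadicRationals) ∧
      ¬ AddGroup.FG dyadicRationals :=
  ⟨⟨(MulEquiv.ofBijective BaumslagGersten.outerTwist
    ⟨BaumslagGersten.outerTwist_injective, BaumslagGersten.outerTwist_surjective⟩).symm⟩,
    dyadicRationals_not_fg⟩
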